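/- Let $\Gamma$ be the vertex set of a connected graph without loops whose vertex degrees are bounded by some $K<\infty$, let $\operatorname{dist}$ be a metric on $\Gamma$ (for example the graph distance, or $\|x-y\|_\infty$ on $\mathbb Z^d$), let $\lambda>0$, and let $\mu$ be a probability measure on a compact interval $[a,b]$, $a<b$. On $\Omega=[a,b]^\Gamma$ with $\mathbb P=\bigotimes_{x\in\Gamma}\mu$ consider the Anderson model on $\ell^2(\Gamma)$, $$(H_\omega\psi)(x)=-\sum_{y\sim x}\bigl(\psi(y)-\psi(x)\bigr)+\lambda\,\omega_x\psi(x).$$ Let $I\subset\mathbb R$ be an interval and suppose that $H_\omega$ exhibits dynamical localization in $I$: there are constants $c,C>0$ and $\zeta\in(0,1]$ such that for all $x,y\in\Gamma$ $$\mathbb E\Bigl(\sup_{t\in\mathbb R}\bigl|\langle\delta_y,e^{-itH_\omega}\chi_I(H_\omega)\delta_x\rangle\bigr|\Bigr)\le C e^{-c\operatorname{dist}(x,y)^\zeta}.$$ Suppose also that the balls $B(x,r)$ of $\Gamma$ are finite and that, for every $\varepsilon>0$ and $x\in\Gamma$, $\# B(x,r)=O(e^{\varepsilon r^\zeta})$ (this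 always holds for $\Gamma=\mathbb Z^d$). Then $H_\omega$ exhibits Anderson localization in $I$; that is, for $\mathbb P$-almost every $\omega$ the following hold. 1. The spectrum of $H_\omega$ in $I$ is pure point: for every $\varphi\in\ell^2(\Gamma)$ the restriction to $I$ of the spectral measure of $H_\omega$ at $\varphi$ is carried by a countable set; and $\sigma(H_\omega)\cap I^\circ=\sigma_{pp}(H_\omega)\cap I^\circ$, where $I^\circ$ is the interior of $I$ and $\sigma_{pp}(H_\omega)$ is the spectrum of the restriction of $H_\omega$ to the subspace of those $\varphi$ whose spectral measure is carried by a countable set. 2. For every $E\in I$, the eigenspace $\ker(H_\omega-E)$ is the closed linear span of those of its elements $\varphi$ that decay (sub)exponentially, in the sense that for every $\varepsilon>0$ there is $C'>0$ with $|\varphi(x)|\le C' e^{-(c-\varepsilon)\operatorname{dist}(x,x_0)^\zeta}$ for all $x\in\Gamma$ and every center of localization $x_0$ of $\varphi$, i.e. every $x_0$ with $|\varphi(x_0)|=\sup_x|\varphi(x)|$. 3. For every $\varepsilon>0$ and $x_0\in\Gamma$ there is a constant $C_{\omega,\varepsilon,x_0}>0$ such that every normalized eigenfunction $\varphi$ of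 $H_\omega$ that has $x_0$ as a center of localization and belongs to a simple eigenvalue in $I$ satisfies $$|\varphi(x)|\le C_{\omega,\varepsilon,x_0}\,e^{-(c-\varepsilon)\operatorname{dist}(x,x_0)^\zeta}\qquad\text{for all }x\in\Gamma.$$ 4. If $\mu$ has no atoms, then the assertion in 3 holds for all normalized eigenfunctions of $H_\omega$ with eigenvalue in $I$ that have $x_0$ as a center of localization. -/

import Mathlib

open MeasureTheory
open scoped ENNReal CompactlySupported

noncomputable section

namespace Anderson

/-! ### Spectral theory of a bounded self-adjoint operator -/

section Spectral

variable {E : Type*} [NormedAddCommGroup E] [InnerProductSpace ℂ E] [CompleteSpace E]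

/-- The positive functional `f ↦ ⟨φ, f(T) φ⟩` on compactly supported continuous functions on `ℝ`,
where `f(T)` is given by the continuous functional calculus. -/
def spectralFunctional (T : E →L[ℂ] E) (φ : E) : C_c(ℝ, ℝ) →ₚ[ℝ] ℝ :=
  PositiveLinearMap.mk₀
    { toFun := fun f => (inner ℂ φ (cfc (f : ℝ → ℝ) T φ)).re
      map_add' := fun f g => by
        have h : cfc ((f + g : C_c(ℝ, ℝ)) : ℝ → ℝ) T = cfc (f : ℝ → ℝ) T + cfc (g : ℝ → ℝ) T :=
          cfc_add T (f : ℝ → ℝ) (g : ℝ → ℝ) f.continuous.continuousOn g.continuous.continuousOn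
        rw [h]
        simp
      map_smul' := fun r f => by
        have h : cfc ((r • f : C_c(ℝ, ℝ)) : ℝ → ℝ) T = r • cfc (f : ℝ → ℝ) T :=
          cfc_smul r (f : ℝ → ℝ) T f.continuous.continuousOn
        rw [h]
        simp [inner_smul_right_eq_smul] }
    (fun f hf => by
      have h : 0 ≤ cfc (f : ℝ → ℝ) T := cfc_nonneg fun x _ => hf x
      have h2 := ((ContinuousLinearMap.nonneg_iff_isPositive _).1 h).inner_nonneg_right φ
      exact (Complex.le_def.1 h2).1)

/-- The spectral measure of the self-adjoint operator `T` at the vector `φ`: the Borel measure on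
`ℝ` with `⟨φ, f(T) φ⟩ = ∫ f dμ` for continuous `f`. -/
def spectralMeasure (T : E →L[ℂ] E) (φ : E) : Measure ℝ :=
  RealRMK.rieszMeasure (spectralFunctional T φ)

/-- The spectral subspace of `T` for a Borel set `I`, made of the vectors whose spectral measure
is carried by `I` (for self-adjoint `T` these already form a closed subspace). -/
def spectralSubspace (T : E →L[ℂ] E) (I : Set ℝ) : Submodule ℂ E :=
  (Submodule.span ℂ {φ : E | spectralMeasure T φ Iᶜ = 0}).topologicalClosure

instance (T : E →L[ℂ] E) (I : Set ℝ) : CompleteSpace (spectralSubspace T I) :=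
  inferInstanceAs (CompleteSpace
    (Submodule.span ℂ {φ : E | spectralMeasure T φ Iᶜ = 0}).topologicalClosure)

/-- The spectral projection `χ_I(T)`. -/
def spectralProjection (T : E →L[ℂ] E) (I : Set ℝ) : E →L[ℂ] E :=
  (spectralSubspace T I).starProjection

/-- The unitary group `exp(-itT)`. -/
def evolution (T : E →L[ℂ] E) (t : ℝ) : E →L[ℂ] E :=
  NormedSpace.exp ((-(Complex.I * (t : ℂ))) • T)

/-- A measure on `ℝ` is pure point if it is carried by a countable set. -/
def IsPurePoint (ν : Measure ℝ) : Prop :=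
  ∃ S : Set ℝ, S.Countable ∧ ν Sᶜ = 0

/-- The pure point subspace `H_pp`: the vectors whose spectral measure is pure point. -/
def purePointSpace (T : E →L[ℂ] E) : Set E :=
  {φ | IsPurePoint (spectralMeasure T φ)}

/-- The pure point spectrum `σ_pp(T)`: the spectrum of the restriction of `T` to `H_pp`. -/
def purePointSpectrum (T : E →L[ℂ] E) : Set ℝ :=
  {e | ¬ Set.BijOn (fun φ => T φ - (e : ℂ) • φ) (purePointSpace T) (purePointSpace T)}

/-- `T` has pure point spectrum in `I`: the part in `I` of every spectral measure is pure point,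
and the spectrum and the pure point spectrum agree in `I`, up to end points of `I`. -/
def HasPurePointSpectrumIn (T : E →L[ℂ] E) (I : Set ℝ) : Prop :=
  (∀ φ : E, IsPurePoint ((spectralMeasure T φ).restrict I)) ∧
    spectrum ℝ T ∩ interior I = purePointSpectrum T ∩ interior I

/-- The space of solutions of `T φ = e φ`. -/
def eigenspace (T : E →L[ℂ] E) (e : ℝ) : Submodule ℂ E :=
  Module.End.eigenspace (T : E →ₗ[ℂ] E) (e : ℂ)

end Spectral

/-! ### The Anderson model on a graph -/

section Model

variable {Γ : Type*}

/-- The Hilbert space `ℓ²(Γ)`. -/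
abbrev l2 (Γ : Type*) : Type _ := lp (fun _ : Γ => ℂ) 2

/-- The canonical basis vector at `x`. -/
def delta (x : Γ) : l2 Γ :=
  haveI := Classical.decEq Γ
  lp.single 2 x (1 : ℂ)

theorem sum_sq_le (ψ : l2 Γ) (s : Finset Γ) : ∑ x ∈ s, ‖ψ x‖ ^ 2 ≤ ‖ψ‖ ^ 2 := by
  have h := lp.sum_rpow_le_norm_rpow (p := 2) (by norm_num) ψ s
  simpa using h

theorem memlp_of_sum_sq_le {f : Γ → ℂ} {M : ℝ} (h : ∀ s : Finset Γ, ∑ x ∈ s, ‖f x‖ ^ 2 ≤ M) :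
    Memℓp f 2 :=
  memℓp_gen' (C := M) fun s => by simpa using h s

theorem norm_le_of_sum_sq_le (f : l2 Γ) {M : ℝ} (hM : 0 ≤ M)
    (h : ∀ s : Finset Γ, ∑ x ∈ s, ‖f x‖ ^ 2 ≤ M ^ 2) : ‖f‖ ≤ M :=
  lp.norm_le_of_forall_sum_le (p := 2) (by norm_num) hM fun s => by simpa using h s

theorem laplacian_sum_sq_le (G : SimpleGraph Γ) [G.LocallyFinite] (K : ℕ)
    (hK : ∀ x, G.degree x ≤ K) (ψ : l2 Γ) (s : Finset Γ) :
    ∑ x ∈ s, ‖-∑ y ∈ G.neighborFinset x, (ψ y - ψ x)‖ ^ 2 ≤ (2 * K * ‖ψ‖) ^ 2 := by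
  classical
  have h1 : ∀ x, ‖-∑ y ∈ G.neighborFinset x, (ψ y - ψ x)‖ ^ 2 ≤
      2 * K * ∑ y ∈ G.neighborFinset x, ‖ψ y‖ ^ 2 + 2 * K * (K * ‖ψ x‖ ^ 2) := by
    intro x
    have hc : ((G.neighborFinset x).card : ℝ) ≤ K := by exact_mod_cast hK x
    calc ‖-∑ y ∈ G.neighborFinset x, (ψ y - ψ x)‖ ^ 2
        ≤ (∑ y ∈ G.neighborFinset x, ‖ψ y - ψ x‖) ^ 2 := by
          rw [norm_neg]; gcongr; exact norm_sum_le _ _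
      _ ≤ (G.neighborFinset x).card * ∑ y ∈ G.neighborFinset x, ‖ψ y - ψ x‖ ^ 2 :=
          sq_sum_le_card_mul_sum_sq
      _ ≤ K * ∑ y ∈ G.neighborFinset x, (2 * ‖ψ y‖ ^ 2 + 2 * ‖ψ x‖ ^ 2) := by
          gcongr with y _
          have := norm_sub_le (ψ y) (ψ x)
          nlinarith [sq_nonneg (‖ψ y‖ - ‖ψ x‖), norm_nonneg (ψ y - ψ x)]
      _ = 2 * K * ∑ y ∈ G.neighborFinset x, ‖ψ y‖ ^ 2
            + 2 * K * ((G.neighborFinset x).card * ‖ψ x‖ ^ 2) := by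
          rw [Finset.sum_add_distrib, ← Finset.mul_sum, Finset.sum_const, nsmul_eq_mul]; ring
      _ ≤ _ := by gcongr
  have h2 : ∑ x ∈ s, ∑ y ∈ G.neighborFinset x, ‖ψ y‖ ^ 2 ≤ K * ‖ψ‖ ^ 2 := by
    have e : ∑ x ∈ s, ∑ y ∈ G.neighborFinset x, ‖ψ y‖ ^ 2 =
        ∑ y ∈ s.biUnion fun x => G.neighborFinset x,
          ∑ x ∈ s.filter fun x => G.Adj x y, ‖ψ y‖ ^ 2 := by
      refine Finset.sum_comm' fun x y => ?_
      simp only [SimpleGraph.mem_neighborFinset, Finset.mem_filter, Finset.mem_biUnion]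
      exact ⟨fun h => ⟨h, x, h⟩, fun h => h.1⟩
    rw [e]
    calc _ ≤ ∑ y ∈ s.biUnion fun x => G.neighborFinset x, K * ‖ψ y‖ ^ 2 := by
          refine Finset.sum_le_sum fun y _ => ?_
          rw [Finset.sum_const, nsmul_eq_mul]
          have : (s.filter fun x => G.Adj x y).card ≤ K := by
            refine le_trans (Finset.card_le_card ?_) (hK y)
            intro x hx
            simpa using (Finset.mem_filter.1 hx).2.symm
          gcongr
      _ = K * ∑ y ∈ s.biUnion fun x => G.neighborFinset x, ‖ψ y‖ ^ 2 := by
          rw [Finset.mul_sum]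
      _ ≤ _ := by gcongr; exact sum_sq_le ψ _
  calc _ ≤ ∑ x ∈ s, (2 * K * ∑ y ∈ G.neighborFinset x, ‖ψ y‖ ^ 2
          + 2 * K * (K * ‖ψ x‖ ^ 2)) := Finset.sum_le_sum fun x _ => h1 x
    _ = 2 * K * ∑ x ∈ s, ∑ y ∈ G.neighborFinset x, ‖ψ y‖ ^ 2
          + 2 * K * (K * ∑ x ∈ s, ‖ψ x‖ ^ 2) := by
        rw [Finset.sum_add_distrib, ← Finset.mul_sum, ← Finset.mul_sum, ← Finset.mul_sum]
    _ ≤ 2 * K * (K * ‖ψ‖ ^ 2) + 2 * K * (K * ‖ψ‖ ^ 2) := by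
        gcongr; exact sum_sq_le ψ s
    _ = _ := by ring

/-- The operator `-Δ` on `ℓ²(Γ)`, `(-Δψ)(x) = -∑_{y ∼ x} (ψ(y) - ψ(x))`. -/
def negLaplacian (G : SimpleGraph Γ) [G.LocallyFinite] (K : ℕ) (hK : ∀ x, G.degree x ≤ K) :
    l2 Γ →L[ℂ] l2 Γ :=
  LinearMap.mkContinuous
    { toFun := fun ψ => (⟨fun x => -∑ y ∈ G.neighborFinset x, (ψ y - ψ x),
        memlp_of_sum_sq_le (laplacian_sum_sq_le G K hK ψ)⟩ : l2 Γ)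
      map_add' := fun ψ φ => by
        ext x
        simp only [lp.coeFn_add, Pi.add_apply]
        rw [← neg_add, ← Finset.sum_add_distrib]
        congr 1
        exact Finset.sum_congr rfl fun y _ => by ring
      map_smul' := fun r ψ => by
        ext x
        simp only [lp.coeFn_smul, Pi.smul_apply, smul_eq_mul, RingHom.id_apply]
        rw [mul_neg, Finset.mul_sum]
        congr 1
        exact Finset.sum_congr rfl fun y _ => by ring }
    (2 * K) fun ψ => norm_le_of_sum_sq_le _ (by positivity) (laplacian_sum_sq_le G K hK ψ)

theorem potential_sum_sq_le {v : Γ → ℝ} {M : ℝ} (hv : ∀ x, |v x| ≤ M) (ψ : l2 Γ)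
    (s : Finset Γ) : ∑ x ∈ s, ‖(v x : ℂ) * ψ x‖ ^ 2 ≤ (M * ‖ψ‖) ^ 2 := by
  calc _ ≤ ∑ x ∈ s, M ^ 2 * ‖ψ x‖ ^ 2 := by
        refine Finset.sum_le_sum fun x _ => ?_
        rw [norm_mul, mul_pow, Complex.norm_real, Real.norm_eq_abs]
        have := hv x
        gcongr
    _ = M ^ 2 * ∑ x ∈ s, ‖ψ x‖ ^ 2 := by rw [Finset.mul_sum]
    _ ≤ M ^ 2 * ‖ψ‖ ^ 2 := by gcongr; exact sum_sq_le ψ s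
    _ = _ := by ring

theorem abs_coe_Icc_le {a b : ℝ} (r : Set.Icc a b) : |(r : ℝ)| ≤ |a| + |b| := by
  have h1 := r.2.1
  have h2 := r.2.2
  rw [abs_le]
  exact ⟨by linarith [neg_abs_le a, abs_nonneg b], by linarith [le_abs_self b, abs_nonneg a]⟩

/-- The Anderson potential, `(V_ω ψ)(x) = ω_x ψ(x)`, for `ω ∈ [a,b]^Γ`. -/
def potential {a b : ℝ} (ω : Γ → Set.Icc a b) : l2 Γ →L[ℂ] l2 Γ :=
  LinearMap.mkContinuous
    { toFun := fun ψ => (⟨fun x => ((ω x : ℝ) : ℂ) * ψ x,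
        memlp_of_sum_sq_le (potential_sum_sq_le (fun x => abs_coe_Icc_le (ω x)) ψ)⟩ : l2 Γ)
      map_add' := fun ψ φ => by
        ext x
        simp only [lp.coeFn_add, Pi.add_apply]
        ring
      map_smul' := fun r ψ => by
        ext x
        simp only [lp.coeFn_smul, Pi.smul_apply, smul_eq_mul, RingHom.id_apply]
        ring }
    (|a| + |b|) fun ψ => norm_le_of_sum_sq_le _ (by positivity)
      (potential_sum_sq_le (fun x => abs_coe_Icc_le (ω x)) ψ)

/-- The Anderson model `H_ω = -Δ + λ V_ω` on `ℓ²(Γ)` with disorder `λ = lam`. -/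
def hamiltonian (G : SimpleGraph Γ) [G.LocallyFinite] (K : ℕ) (hK : ∀ x, G.degree x ≤ K)
    (lam : ℝ) {a b : ℝ} (ω : Γ → Set.Icc a b) : l2 Γ →L[ℂ] l2 Γ :=
  negLaplacian G K hK + (lam : ℂ) • potential ω

/-- Dynamical localization in `I` with constants `c`, `C`, `ζ` of a random operator `H` on
`ℓ²(Γ)`:
`𝔼 (sup_t |⟨δ_y, exp(-itH_ω) χ_I(H_ω) δ_x⟩|) ≤ C exp(-c dist(x,y)^ζ)` for all `x`, `y`. -/
def DynamicallyLocalized {Ω : Type*} [MeasurableSpace Ω] (P : Measure Ω) [MetricSpace Γ]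
    (H : Ω → (l2 Γ →L[ℂ] l2 Γ)) (I : Set ℝ) (c C ζ : ℝ) : Prop :=
  ∀ x y : Γ,
    ∫⁻ ω, ⨆ t : ℝ,
      ‖inner ℂ (delta y) (evolution (H ω) t (spectralProjection (H ω) I (delta x)))‖ₑ ∂P
      ≤ ENNReal.ofReal (C * Real.exp (-c * dist x y ^ ζ))

/-- `x₀` is a center of localization of `φ`. -/
def IsCenter (φ : l2 Γ) (x₀ : Γ) : Prop :=
  ∀ x, ‖φ x‖ ≤ ‖φ x₀‖

/-- `φ` decays (sub)exponentially around its centers of localization, with every rate below `c`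
and exponent `ζ`. -/
def Decays [MetricSpace Γ] (φ : l2 Γ) (c ζ : ℝ) : Prop :=
  ∀ ε > 0, ∃ C > 0, ∀ x₀, IsCenter φ x₀ →
    ∀ x, ‖φ x‖ ≤ C * Real.exp (-(c - ε) * dist x x₀ ^ ζ)

/-- All normalized eigenfunctions of `T` with eigenvalue in `S` decay (sub)exponentially around
their centers of localization `x₀`, with a constant that depends on `x₀` but not on the
eigenfunction. -/
def EigenfunctionsDecay [MetricSpace Γ] (T : l2 Γ →L[ℂ] l2 Γ) (S : Set ℝ) (c ζ : ℝ) : Prop :=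
  ∀ ε > 0, ∀ x₀ : Γ, ∃ C > 0, ∀ e ∈ S, ∀ φ ∈ eigenspace T e, ‖φ‖ = 1 → IsCenter φ x₀ →
    ∀ x, ‖φ x‖ ≤ C * Real.exp (-(c - ε) * dist x x₀ ^ ζ)

/-- The balls of `Γ` are finite and their volume is `O(exp(ε r^ζ))` for every `ε > 0`. -/
def SubexponentialGrowth (Γ : Type*) [MetricSpace Γ] (ζ : ℝ) : Prop :=
  ∀ ε > 0, ∀ x : Γ, ∃ C : ℝ, ∀ r : ℝ, 0 ≤ r → (Metric.closedBall x r).Finite ∧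
    ((Metric.closedBall x r).ncard : ℝ) ≤ C * Real.exp (ε * r ^ ζ)

end Model

end Anderson

end

noncomputable section

namespace Anderson

open Filter Topology ComplexConjugate

set_option linter.unusedSectionVars false

section SpectralTheory

variable {E : Type*} [NormedAddCommGroup E] [InnerProductSpace ℂ E] [CompleteSpace E]

/-! ### Spectral measures and the continuous functional calculus -/

/-! Weight `sup_t |⟨δ_y, exp(-itH) χ_I(H) δ_x⟩|` by `exp((c - ε) dist(x,y)^ζ)` and sum over `y`. By
subexponential growth the expectation is finite, so almost surely every orbit of `χ_I(H) δ_x` is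
dominated, uniformly in time, by a multiple of `exp(-(c - ε) dist(x,y)^ζ)`. This is `OrbitsDecay`,
obtained in `ae_orbitsDecay`; items 1 to 3 follow from it for each fixed `ω`.

Pure point spectrum is a RAGE argument. By Wiener's lemma, an orbit that starts orthogonally to all
eigenvectors has vanishing average overlap with any fixed vector, whereas a summable dominating
function keeps the orbit from escaping. Hence each `χ_I(H) δ_x` lies in the closed span of the
eigenvectors (`mem_eigenvectorSpan_of_summable`), and by density so does the range of `χ_I(H)`.

For `e ∈ I` the eigenprojection `P_e` is a time average of `exp(ite) exp(-itH) χ_I(H)`, so its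
kernel inherits the bound (`norm_inner_spectralProjection_singleton_le`). The vectors `P_e δ_x` span
the eigenspace densely, which gives item 2. If `e` is simple, the kernel is `conj (φ x) * φ y`, so
`|φ(x₀)| |φ(y)|` decays. At a center `x₀` the factor `|φ(x₀)|` is bounded below, because the same
bound forces a fixed share of the mass into a finite set depending only on `x₀` and `ω`. This gives
item 3.

For item 4, eigenvalues are almost surely simple when `μ` has no atoms. Otherwise some eigenvalue
`e` has eigenfunctions `φ`, `ψ ≠ 0` with `φ(x) ≠ 0` and `ψ(x) = 0`. Then `ψ` does not feel `ω_x`, so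
`e` lies in a countable set independent of `ω_x`, while each `e` admits such a `φ` for at most one
value of `ω_x`. The bad values of `ω_x` are thus countable, and Fubini concludes. -/

theorem integral_spectralMeasure_of_compactSupport (T : E →L[ℂ] E) (φ : E) (f : C_c(ℝ, ℝ)) :
    ∫ x, f x ∂spectralMeasure T φ = (inner ℂ φ (cfc (f : ℝ → ℝ) T φ)).re :=
  RealRMK.integral_rieszMeasure _ f

instance (T : E →L[ℂ] E) (φ : E) : (spectralMeasure T φ).Regular := by
  unfold spectralMeasure; infer_instance

/-- A bump function that is one at `x` and zero on the spectrum acts as the zero operator, so its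
integral vanishes and `x` has a null neighbourhood. -/
theorem spectralMeasure_compl_spectrum (T : E →L[ℂ] E) (φ : E) :
    spectralMeasure T φ (spectrum ℝ T)ᶜ = 0 := by
  refine measure_null_of_locally_null _ fun x hx => ?_
  obtain ⟨f, hf1, hf0, hfc, hf01⟩ := exists_continuous_one_zero_of_isCompact
    (isCompact_singleton (x := x)) (spectrum.isClosed (𝕜 := ℝ) T)
    (Set.disjoint_singleton_left.2 hx)
  let g : C_c(ℝ, ℝ) := ⟨f, hfc⟩
  have hint : ∫ y, g y ∂spectralMeasure T φ = 0 := by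
    rw [integral_spectralMeasure_of_compactSupport]
    have : cfc (g : ℝ → ℝ) T = 0 :=
      (cfc_congr (g := fun _ => 0) (fun y hy => hf0 hy)).trans (cfc_const_zero ℝ T)
    rw [this]; simp
  have hgi : Integrable (fun y => g y) (spectralMeasure T φ) :=
    g.continuous.integrable_of_hasCompactSupport g.hasCompactSupport
  have hae := (integral_eq_zero_iff_of_nonneg (fun y => (hf01 y).1) hgi).1 hint
  refine ⟨{y | 0 < f y}, mem_nhdsWithin_of_mem_nhds
    ((isOpen_lt continuous_const f.continuous).mem_nhds ?_), ?_⟩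
  · have := hf1 (Set.mem_singleton x)
    simp [this]
  · refine measure_mono_null (fun y hy => ?_) hae
    exact ne_of_gt hy

instance (T : E →L[ℂ] E) (φ : E) : IsFiniteMeasure (spectralMeasure T φ) := by
  refine ⟨?_⟩
  rw [← Set.union_compl_self (spectrum ℝ T)]
  refine (measure_union_le _ _).trans_lt ?_
  rw [spectralMeasure_compl_spectrum, add_zero]
  exact (spectrum.isCompact (𝕜 := ℝ) T).measure_lt_top

theorem ae_mem_spectrum (T : E →L[ℂ] E) (φ : E) :
    ∀ᵐ x ∂spectralMeasure T φ, x ∈ spectrum ℝ T :=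
  spectralMeasure_compl_spectrum T φ

theorem integrable_spectralMeasure (T : E →L[ℂ] E) (φ : E) {F : Type*} [NormedAddCommGroup F]
    {f : ℝ → F} (hf : Continuous f) : Integrable f (spectralMeasure T φ) := by
  have h : (spectralMeasure T φ).restrict (spectrum ℝ T) = spectralMeasure T φ :=
    Measure.restrict_eq_self_of_ae_mem (ae_mem_spectrum T φ)
  rw [← h]
  exact hf.continuousOn.integrableOn_compact (spectrum.isCompact (𝕜 := ℝ) T)

/-- A cutoff equal to one on the compact spectrum changes neither side, which removes the compact
support. -/
theorem integral_spectralMeasure (T : E →L[ℂ] E) (φ : E) {f : ℝ → ℝ} (hf : Continuous f) :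
    ∫ x, f x ∂spectralMeasure T φ = (inner ℂ φ (cfc f T φ)).re := by
  obtain ⟨χ, hχ1, -, hχc, -⟩ := exists_continuous_one_zero_of_isCompact
    (spectrum.isCompact (𝕜 := ℝ) T) (isClosed_empty (X := ℝ)) (Set.disjoint_empty _)
  let g : C_c(ℝ, ℝ) := ⟨⟨fun x => χ x * f x, χ.continuous.mul hf⟩, hχc.mul_right⟩
  have hg : Set.EqOn f g (spectrum ℝ T) := fun x hx => by
    change f x = χ x * f x
    rw [hχ1 hx]; simp
  rw [cfc_congr hg, ← integral_spectralMeasure_of_compactSupport]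
  refine integral_congr_ae ?_
  filter_upwards [ae_mem_spectrum T φ] with x hx using hg hx

/-- The operator `f(T)` for a self-adjoint operator `T` and a continuous function `f : ℝ → ℂ`. -/
def fc (T : E →L[ℂ] E) (f : ℝ → ℂ) : E →L[ℂ] E := cfc (fun z : ℂ => f z.re) T

variable {T : E →L[ℂ] E}

theorem fc_mul (T : E →L[ℂ] E) {f g : ℝ → ℂ} (hf : Continuous f) (hg : Continuous g) :
    fc T (fun x => f x * g x) = fc T f * fc T g :=
  cfc_mul _ _ T (hf.comp Complex.continuous_re).continuousOn
    (hg.comp Complex.continuous_re).continuousOn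

theorem fc_sub (T : E →L[ℂ] E) {f g : ℝ → ℂ} (hf : Continuous f) (hg : Continuous g) :
    fc T (fun x => f x - g x) = fc T f - fc T g :=
  cfc_sub _ _ T (hf.comp Complex.continuous_re).continuousOn
    (hg.comp Complex.continuous_re).continuousOn

theorem fc_add (T : E →L[ℂ] E) {f g : ℝ → ℂ} (hf : Continuous f) (hg : Continuous g) :
    fc T (fun x => f x + g x) = fc T f + fc T g :=
  cfc_add T _ _ (hf.comp Complex.continuous_re).continuousOn
    (hg.comp Complex.continuous_re).continuousOn

theorem fc_const_mul (T : E →L[ℂ] E) (r : ℂ) {f : ℝ → ℂ} (hf : Continuous f) :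
    fc T (fun x => r * f x) = r • fc T f :=
  cfc_const_mul r _ T (hf.comp Complex.continuous_re).continuousOn

theorem fc_const (hT : IsSelfAdjoint T) (r : ℂ) : fc T (fun _ => r) = r • 1 := by
  have := hT.isStarNormal
  rw [fc, cfc_const r T, Algebra.algebraMap_eq_smul_one]

theorem fc_sum (T : E →L[ℂ] E) {ι : Type*} (s : Finset ι) {f : ι → ℝ → ℂ}
    (hf : ∀ i, Continuous (f i)) :
    fc T (fun x => ∑ i ∈ s, f i x) = ∑ i ∈ s, fc T (f i) := by
  have := cfc_sum (fun i (z : ℂ) => f i z.re) T s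
    (fun i _ => ((hf i).comp Complex.continuous_re).continuousOn)
  refine Eq.trans ?_ this
  rw [fc]
  congr 1
  ext z
  simp

theorem star_fc (T : E →L[ℂ] E) (f : ℝ → ℂ) : star (fc T f) = fc T fun x => conj (f x) :=
  (cfc_star _ T).symm

theorem fc_ofReal (hT : IsSelfAdjoint T) (f : ℝ → ℝ) : fc T (fun x => (f x : ℂ)) = cfc f T :=
  (cfc_real_eq_complex f hT).symm

theorem fc_id (hT : IsSelfAdjoint T) : fc T (fun x => (x : ℂ)) = T :=
  (fc_ofReal hT (fun x => x)).trans (cfc_id' ℝ T)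

theorem evolution_eq_fc (hT : IsSelfAdjoint T) (t : ℝ) :
    evolution T t = fc T fun x => Complex.exp (-(Complex.I * t) * x) := by
  have hn := hT.isStarNormal
  have hn' : IsStarNormal ((-(Complex.I * (t : ℂ))) • T) := inferInstance
  rw [evolution, ← CFC.complex_exp_eq_normedSpace_exp,
    ← cfc_comp_smul (-(Complex.I * (t : ℂ))) Complex.exp T (Complex.continuous_exp.continuousOn)]
  refine cfc_congr fun z hz => ?_
  rw [← hT.spectrumRestricts.algebraMap_image] at hz
  obtain ⟨x, hx, rfl⟩ := hz
  simp

theorem fc_eq_re_add_im {f : ℝ → ℂ} (hf : Continuous f) :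
    fc T f = fc T (fun x => ((f x).re : ℂ)) + Complex.I • fc T (fun x => ((f x).im : ℂ)) := by
  rw [← fc_const_mul T _ (by fun_prop), ← fc_add T (by fun_prop) (by fun_prop)]
  congr 1
  ext x
  rw [mul_comm]; exact (Complex.re_add_im _).symm

theorem inner_fc (hT : IsSelfAdjoint T) (φ : E) {f : ℝ → ℂ} (hf : Continuous f) :
    inner ℂ φ (fc T f φ) = ∫ x, f x ∂spectralMeasure T φ := by
  have key : ∀ g : ℝ → ℝ, Continuous g →
      inner ℂ φ (cfc g T φ) = ((∫ x, g x ∂spectralMeasure T φ : ℝ) : ℂ) := by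
    intro g hg
    rw [integral_spectralMeasure T φ hg]
    have hs : IsSelfAdjoint (cfc g T) := cfc_predicate g T
    have := ContinuousLinearMap.isSelfAdjoint_iff_isSymmetric.1 hs
    exact (Complex.conj_eq_iff_re.1 (by rw [inner_conj_symm]; exact this φ φ)).symm
  have hre : Continuous fun x => (f x).re := by fun_prop
  have him : Continuous fun x => (f x).im := by fun_prop
  rw [fc_eq_re_add_im hf, fc_ofReal hT, fc_ofReal hT, add_apply, smul_apply, inner_add_right,
    inner_smul_right, key _ hre, key _ him,
    ← integral_re_add_im (integrable_spectralMeasure T φ hf)]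
  simp [mul_comm]

theorem inner_fc_left (T : E →L[ℂ] E) (f : ℝ → ℂ) (φ ψ : E) :
    inner ℂ (fc T f φ) ψ = inner ℂ φ (fc T (fun x => conj (f x)) ψ) := by
  rw [← star_fc, ContinuousLinearMap.star_eq_adjoint, ContinuousLinearMap.adjoint_inner_right]

/-- This isometry turns strong convergence of functions of `T` at `φ` into `L²` convergence for the
spectral measure; the operator limits below rest on it. -/
theorem norm_fc_sq (hT : IsSelfAdjoint T) (φ : E) {f : ℝ → ℂ} (hf : Continuous f) :
    ‖fc T f φ‖ ^ 2 = ∫ x, ‖f x‖ ^ 2 ∂spectralMeasure T φ := by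
  have h : inner ℂ (fc T f φ) (fc T f φ) =
      ((∫ x, ‖f x‖ ^ 2 ∂spectralMeasure T φ : ℝ) : ℂ) := by
    rw [inner_fc_left, ← mul_apply_eq_comp, 
      ← fc_mul T (by fun_prop) hf, inner_fc hT φ (by fun_prop), ← integral_complex_ofReal]
    congr 1
    ext x
    rw [Complex.conj_mul']
    push_cast; rfl
  rw [inner_self_eq_norm_sq_to_K] at h
  exact Complex.ofReal_injective (by simpa using h)

theorem norm_sq_eq_spectralMeasure (hT : IsSelfAdjoint T) (φ : E) :
    ‖φ‖ ^ 2 = (spectralMeasure T φ).real Set.univ := by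
  have := norm_fc_sq hT φ (f := fun _ => 1) continuous_const
  rw [fc_const hT] at this
  simpa using this

end SpectralTheory

/-! ### Spectral projections -/

/-- `f` is a sequence of continuous functions with values in `[0,1]` that converges `μ`-almost
everywhere to the indicator function of `S`. -/
structure IndicatorApprox (f : ℕ → ℝ → ℝ) (S : Set ℝ) (μ : Measure ℝ) : Prop where
  continuous : ∀ n, Continuous (f n)
  mem_Icc : ∀ n x, f n x ∈ Set.Icc (0 : ℝ) 1
  tendsto : ∀ᵐ x ∂μ, Tendsto (fun n => f n x) atTop (𝓝 (S.indicator (fun _ => 1) x))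

/-- Bounded continuous functions are dense in `L¹`; a subsequence converges almost everywhere, and
clipping to `[0,1]` preserves the limit. -/
theorem exists_indicatorApprox (μ : Measure ℝ) [IsFiniteMeasure μ] {S : Set ℝ}
    (hS : MeasurableSet S) : ∃ f, IndicatorApprox f S μ := by
  have hmem : MemLp (S.indicator fun _ => (1 : ℝ)) 1 μ :=
    memLp_indicator_const 1 hS 1 (Or.inr (measure_ne_top μ S))
  have hε : ∀ n : ℕ, ((n : ℝ≥0∞) + 1)⁻¹ ≠ 0 := fun n => by simp
  choose g hg hgm using fun n : ℕ =>
    hmem.exists_boundedContinuous_eLpNorm_sub_le ENNReal.one_ne_top (hε n)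
  have hlim : Tendsto (fun n => eLpNorm ((fun x => g n x) - S.indicator fun _ => (1 : ℝ)) 1 μ)
      atTop (𝓝 0) := by
    have h0 : Tendsto (fun n : ℕ => ((n : ℝ≥0∞) + 1)⁻¹) atTop (𝓝 0) := by
      have := (tendsto_add_atTop_iff_nat 1).2 ENNReal.tendsto_inv_nat_nhds_zero
      simpa using this
    refine tendsto_of_tendsto_of_tendsto_of_le_of_le tendsto_const_nhds h0 (fun _ => zero_le) ?_
    intro n
    simp only
    rw [eLpNorm_sub_comm]
    exact hg n
  obtain ⟨ns, -, hns⟩ := (tendstoInMeasure_of_tendsto_eLpNorm one_ne_zero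
    (fun n => (g n).continuous.aestronglyMeasurable) hmem.1 hlim).exists_seq_tendsto_ae
  refine ⟨fun n x => max 0 (min 1 (g (ns n) x)), fun n => ?_, fun n x => ?_, ?_⟩
  · exact continuous_const.max (continuous_const.min (g (ns n)).continuous)
  · exact ⟨le_max_left _ _, max_le zero_le_one (min_le_left _ _)⟩
  · filter_upwards [hns] with x hx
    have h1 : S.indicator (fun _ => (1 : ℝ)) x =
        max 0 (min 1 (S.indicator (fun _ => (1 : ℝ)) x)) := by
      by_cases h : x ∈ S <;> simp [h]
    rw [h1]
    exact tendsto_const_nhds.max (tendsto_const_nhds.min hx)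

theorem IndicatorApprox.compl {f : ℕ → ℝ → ℝ} {S : Set ℝ} {μ : Measure ℝ}
    (h : IndicatorApprox f S μ) : IndicatorApprox (fun n x => 1 - f n x) Sᶜ μ where
  continuous n := continuous_const.sub (h.continuous n)
  mem_Icc n x := ⟨by linarith [(h.mem_Icc n x).2], by linarith [(h.mem_Icc n x).1]⟩
  tendsto := by
    filter_upwards [h.tendsto] with x hx
    have h1 : Sᶜ.indicator (fun _ => (1 : ℝ)) x = 1 - S.indicator (fun _ => (1 : ℝ)) x := by
      by_cases h : x ∈ S <;> simp [h]
    rw [h1]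
    exact tendsto_const_nhds.sub hx

section SpectralTheory

variable {E : Type*} [NormedAddCommGroup E] [InnerProductSpace ℂ E] [CompleteSpace E]
variable {T : E →L[ℂ] E}

/-- Dominated convergence through `norm_fc_sq`. A general filter is allowed so that pairs of indices
can be used for Cauchy sequences. -/
theorem tendsto_fc_zero (hT : IsSelfAdjoint T) (φ : E) {ι : Type*} {l : Filter ι}
    [l.IsCountablyGenerated] {g : ι → ℝ → ℂ} (hg : ∀ i, Continuous (g i)) {M : ℝ}
    (hM : ∀ i x, ‖g i x‖ ≤ M)
    (h : ∀ᵐ x ∂spectralMeasure T φ, Tendsto (fun i => g i x) l (𝓝 0)) :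
    Tendsto (fun i => fc T (g i) φ) l (𝓝 0) := by
  have h2 : Tendsto (fun i => ‖fc T (g i) φ‖ ^ 2) l (𝓝 0) := by
    have : Tendsto (fun i => ∫ x, ‖g i x‖ ^ 2 ∂spectralMeasure T φ) l
        (𝓝 (∫ _, (0 : ℝ) ∂spectralMeasure T φ)) := by
      refine tendsto_integral_filter_of_dominated_convergence (fun _ => M ^ 2) ?_ ?_
        (integrable_const _) ?_
      · exact Eventually.of_forall fun i => ((hg i).norm.pow 2).aestronglyMeasurable
      · refine Eventually.of_forall fun i => Eventually.of_forall fun x => ?_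
        rw [Real.norm_of_nonneg (by positivity)]
        have := hM i x
        gcongr
      · filter_upwards [h] with x hx
        simpa using (hx.norm).pow 2
    simpa [norm_fc_sq hT φ (hg _)] using this
  rw [tendsto_zero_iff_norm_tendsto_zero]
  simpa using h2.sqrt

theorem exists_tendsto_fc (hT : IsSelfAdjoint T) (φ : E) {f : ℕ → ℝ → ℝ} {S : Set ℝ}
    (h : IndicatorApprox f S (spectralMeasure T φ)) :
    ∃ ξ, Tendsto (fun n => fc T (fun x => (f n x : ℂ)) φ) atTop (𝓝 ξ) := by
  refine cauchySeq_tendsto_of_complete (cauchySeq_iff_tendsto_dist_atTop_0.2 ?_)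
  have hc := h.continuous
  have h0 := tendsto_fc_zero hT φ (l := (atTop : Filter (ℕ × ℕ)))
    (g := fun p x => (f p.1 x : ℂ) - f p.2 x) (fun p => by fun_prop) (M := 1)
    (fun p x => by
      rw [← Complex.ofReal_sub, Complex.norm_real, Real.norm_eq_abs, abs_le]
      have h1 := h.mem_Icc p.1 x
      have h2 := h.mem_Icc p.2 x
      exact ⟨by linarith [h1.1, h2.2], by linarith [h1.2, h2.1]⟩)
    (by
      filter_upwards [h.tendsto] with x hx
      have hx' : Tendsto (fun n => (f n x : ℂ)) atTop _ :=
        (Complex.continuous_ofReal.tendsto _).comp hx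
      rw [← prod_atTop_atTop_eq]
      simpa using (hx'.comp tendsto_fst).sub (hx'.comp tendsto_snd))
  have h1 := h0.norm
  rw [norm_zero] at h1
  refine h1.congr fun p => ?_
  rw [dist_eq_norm, fc_sub T (by fun_prop) (by fun_prop)]
  rfl

/-- Testing against `g`, the approximants give `∫ f_n² g`, and an indicator function is its own
square. -/
theorem spectralMeasure_of_tendsto (hT : IsSelfAdjoint T) {φ ξ : E} {f : ℕ → ℝ → ℝ} {S : Set ℝ}
    (hS : MeasurableSet S) (h : IndicatorApprox f S (spectralMeasure T φ))
    (hξ : Tendsto (fun n => fc T (fun x => (f n x : ℂ)) φ) atTop (𝓝 ξ)) :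
    spectralMeasure T ξ = (spectralMeasure T φ).restrict S := by
  refine ext_of_forall_integral_eq_of_IsFiniteMeasure fun g => ?_
  have hc := h.continuous
  have hgc := g.continuous
  have h1 : Tendsto (fun n => (inner ℂ (fc T (fun x => (f n x : ℂ)) φ)
      (cfc (g : ℝ → ℝ) T (fc T (fun x => (f n x : ℂ)) φ))).re) atTop
      (𝓝 (inner ℂ ξ (cfc (g : ℝ → ℝ) T ξ)).re) :=
    (Complex.continuous_re.tendsto _).comp
      (hξ.inner (((cfc (g : ℝ → ℝ) T).continuous.tendsto _).comp hξ))
  have h2 : ∀ n, (inner ℂ (fc T (fun x => (f n x : ℂ)) φ)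
      (cfc (g : ℝ → ℝ) T (fc T (fun x => (f n x : ℂ)) φ))).re =
      ∫ x, f n x ^ 2 * g x ∂spectralMeasure T φ := by
    intro n
    rw [integral_spectralMeasure T φ (by fun_prop), inner_fc_left, ← fc_ofReal hT, ← fc_ofReal hT,
      ← mul_apply_eq_comp, ← mul_apply_eq_comp, ← fc_mul T (by fun_prop) (by fun_prop),
      ← fc_mul T (by fun_prop) (by fun_prop)]
    congr 5
    ext x
    simp
    ring
  have h3 : Tendsto (fun n => ∫ x, f n x ^ 2 * g x ∂spectralMeasure T φ) atTop
      (𝓝 (∫ x, S.indicator g x ∂spectralMeasure T φ)) := by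
    refine tendsto_integral_of_dominated_convergence (fun _ => ‖g‖)
      (fun n => (((hc n).pow 2).mul hgc).aestronglyMeasurable)
      (integrable_const _) (fun n => Eventually.of_forall fun x => ?_) ?_
    · rw [norm_mul, norm_pow, Real.norm_of_nonneg (h.mem_Icc n x).1]
      calc f n x ^ 2 * ‖g x‖ ≤ 1 * ‖g‖ := by
            gcongr
            · exact pow_le_one₀ (h.mem_Icc n x).1 (h.mem_Icc n x).2
            · exact g.norm_coe_le_norm x
        _ = ‖g‖ := one_mul _
    · filter_upwards [h.tendsto] with x hx
      have h4 : S.indicator g x = S.indicator (fun _ => (1 : ℝ)) x ^ 2 * g x := by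
        by_cases hxS : x ∈ S <;> simp [hxS]
      rw [h4]
      exact (hx.pow 2).mul_const _
  rw [integral_spectralMeasure T ξ hgc, ← integral_indicator hS]
  simp only [h2] at h1
  exact tendsto_nhds_unique h1 h3

/-- One sequence approximating `χ_S` for the sum of both measures satisfies `f_n(T) φ → φ` and
`f_n(T) ψ → 0`, and `f_n(T)` is symmetric. -/
theorem inner_eq_zero_of_spectralMeasure (hT : IsSelfAdjoint T) {φ ψ : E} {S : Set ℝ}
    (hS : MeasurableSet S) (hφ : spectralMeasure T φ Sᶜ = 0) (hψ : spectralMeasure T ψ S = 0) :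
    inner ℂ φ ψ = 0 := by
  obtain ⟨f, hf⟩ := exists_indicatorApprox (spectralMeasure T φ + spectralMeasure T ψ) hS
  have hc := hf.continuous
  have ht := ae_add_measure_iff.1 hf.tendsto
  have hb : ∀ n x, ‖((f n x : ℝ) : ℂ)‖ ≤ 1 := fun n x => by
    rw [Complex.norm_real, Real.norm_of_nonneg (hf.mem_Icc n x).1]; exact (hf.mem_Icc n x).2
  have h1 : Tendsto (fun n => fc T (fun x => (f n x : ℂ)) ψ) atTop (𝓝 0) := by
    refine tendsto_fc_zero hT ψ (fun n => by fun_prop) hb ?_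
    filter_upwards [ht.2, measure_eq_zero_iff_ae_notMem.1 hψ] with x hx hxS
    have := (Complex.continuous_ofReal.tendsto _).comp hx
    simpa [hxS, Function.comp_def] using this
  have h2 : Tendsto (fun n => fc T (fun x => (f n x : ℂ) - 1) φ) atTop (𝓝 0) := by
    refine tendsto_fc_zero hT φ (M := 2) (fun n => by fun_prop) (fun n x => ?_) ?_
    · refine (norm_sub_le _ _).trans ?_
      rw [norm_one]
      linarith [hb n x]
    · filter_upwards [ht.1, measure_eq_zero_iff_ae_notMem.1 hφ] with x hx hxS
      have hxS : x ∈ S := by simpa using hxS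
      have := ((Complex.continuous_ofReal.tendsto _).comp hx).sub_const 1
      simpa [hxS, Function.comp_def] using this
  have h3 : Tendsto (fun n => fc T (fun x => (f n x : ℂ)) φ) atTop (𝓝 φ) := by
    have := h2.add_const φ
    rw [zero_add] at this
    refine this.congr fun n => ?_
    rw [fc_sub T (by fun_prop) (by fun_prop), fc_const hT]
    simp
  have h4 : Tendsto (fun n => inner ℂ (fc T (fun x => (f n x : ℂ)) φ) ψ) atTop (𝓝 0) := by
    have := (tendsto_const_nhds (x := φ)).inner (𝕜 := ℂ) h1
    rw [inner_zero_right] at this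
    refine this.congr fun n => ?_
    rw [inner_fc_left]
    simp
  exact tendsto_nhds_unique (h3.inner tendsto_const_nhds) h4

theorem mem_spectralSubspace {S : Set ℝ} {φ : E} (h : spectralMeasure T φ Sᶜ = 0) :
    φ ∈ spectralSubspace T S :=
  Submodule.le_topologicalClosure _ (Submodule.subset_span h)

theorem mem_spectralSubspace_orthogonal (hT : IsSelfAdjoint T) {S : Set ℝ} (hS : MeasurableSet S)
    {φ : E} (h : spectralMeasure T φ S = 0) : φ ∈ (spectralSubspace T S)ᗮ := by
  rw [spectralSubspace, Submodule.orthogonal_closure, Submodule.mem_orthogonal]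
  intro u hu
  induction hu using Submodule.span_induction with
  | mem u hu => exact inner_eq_zero_of_spectralMeasure hT hS hu h
  | zero => simp
  | add u v _ _ hu hv => rw [inner_add_left, hu, hv, add_zero]
  | smul r u _ hu => rw [inner_smul_left, hu, mul_zero]

/-- The limit `ξ` has spectral measure carried by `S`, and that of `φ - ξ` does not charge `S`; so
`φ = ξ + (φ - ξ)` is the orthogonal decomposition defining the projection. -/
theorem tendsto_fc_spectralProjection (hT : IsSelfAdjoint T) {φ : E} {f : ℕ → ℝ → ℝ} {S : Set ℝ}
    (hS : MeasurableSet S) (h : IndicatorApprox f S (spectralMeasure T φ)) :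
    Tendsto (fun n => fc T (fun x => (f n x : ℂ)) φ) atTop (𝓝 (spectralProjection T S φ)) := by
  obtain ⟨ξ, hξ⟩ := exists_tendsto_fc hT φ h
  have hc := h.continuous
  have h1 := spectralMeasure_of_tendsto hT hS h hξ
  have hξ' : Tendsto (fun n => fc T (fun x => ((1 - f n x : ℝ) : ℂ)) φ) atTop (𝓝 (φ - ξ)) := by
    refine (hξ.const_sub φ).congr fun n => ?_
    have : (fun x => ((1 - f n x : ℝ) : ℂ)) = fun x => 1 - ((f n x : ℝ) : ℂ) := by
      ext x; push_cast; rfl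
    rw [this, fc_sub T (by fun_prop) (by fun_prop), fc_const hT]
    simp
  have h2 := spectralMeasure_of_tendsto hT hS.compl h.compl hξ'
  have : spectralProjection T S φ = ξ := by
    refine Submodule.eq_starProjection_of_mem_orthogonal (mem_spectralSubspace ?_)
      (mem_spectralSubspace_orthogonal hT hS ?_)
    · rw [h1, Measure.restrict_apply hS.compl]; simp
    · rw [h2, Measure.restrict_apply hS]; simp
  rwa [this]

theorem spectralMeasure_spectralProjection (hT : IsSelfAdjoint T) {S : Set ℝ}
    (hS : MeasurableSet S) (φ : E) :
    spectralMeasure T (spectralProjection T S φ) = (spectralMeasure T φ).restrict S := by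
  obtain ⟨f, hf⟩ := exists_indicatorApprox (spectralMeasure T φ) hS
  exact spectralMeasure_of_tendsto hT hS hf (tendsto_fc_spectralProjection hT hS hf)

theorem inner_spectralProjection_self (T : E →L[ℂ] E) (S : Set ℝ) (φ : E) :
    inner ℂ (spectralProjection T S φ) φ = ((‖spectralProjection T S φ‖ ^ 2 : ℝ) : ℂ) := by
  have h : inner ℂ (spectralProjection T S φ) (φ - spectralProjection T S φ) = 0 :=
    (Submodule.mem_orthogonal _ _).1 ((spectralSubspace T S).sub_starProjection_mem_orthogonal φ) _
      (Submodule.starProjection_apply_mem _ φ)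
  rw [inner_sub_right, sub_eq_zero] at h
  rw [h, inner_self_eq_norm_sq_to_K]
  simp

theorem norm_spectralProjection_sq (hT : IsSelfAdjoint T) {S : Set ℝ} (hS : MeasurableSet S)
    (φ : E) : ‖spectralProjection T S φ‖ ^ 2 = (spectralMeasure T φ).real S := by
  rw [norm_sq_eq_spectralMeasure hT, spectralMeasure_spectralProjection hT hS]
  simp

theorem spectralMeasure_eq_zero_of_inner (hT : IsSelfAdjoint T) {S : Set ℝ} (hS : MeasurableSet S)
    {φ : E} (h : inner ℂ (spectralProjection T S φ) φ = 0) : spectralMeasure T φ S = 0 := by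
  rw [inner_spectralProjection_self, norm_spectralProjection_sq hT hS] at h
  exact (measureReal_eq_zero_iff).1 (by exact_mod_cast h)

/-! ### Eigenspaces -/

theorem mem_eigenspace {e : ℝ} {φ : E} : φ ∈ eigenspace T e ↔ T φ = (e : ℂ) • φ :=
  Module.End.mem_eigenspace_iff

/-- By the isometry, `‖Tφ - eφ‖²` is the integral of `|x - e|²`, which vanishes exactly when the
measure sits at `e`. -/
theorem mem_eigenspace_iff_spectralMeasure (hT : IsSelfAdjoint T) {e : ℝ} {φ : E} :
    φ ∈ eigenspace T e ↔ spectralMeasure T φ {e}ᶜ = 0 := by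
  have hc : Continuous fun x : ℝ => ‖(x : ℂ) - e‖ ^ 2 := by fun_prop
  have h1 : ‖T φ - (e : ℂ) • φ‖ ^ 2 = ∫ x, ‖(x : ℂ) - e‖ ^ 2 ∂spectralMeasure T φ := by
    rw [← norm_fc_sq hT φ (by fun_prop), fc_sub T (by fun_prop) (by fun_prop), fc_id hT,
      fc_const hT]
    simp
  rw [mem_eigenspace, ← sub_eq_zero, ← norm_eq_zero, ← sq_eq_zero_iff, h1,
    integral_eq_zero_iff_of_nonneg (fun x => by positivity) (integrable_spectralMeasure T φ hc)]
  refine Eq.to_iff (congrArg (fun s => spectralMeasure T φ s = 0) ?_)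
  ext x
  simp [sub_eq_zero]

theorem spectralSubspace_singleton (hT : IsSelfAdjoint T) (e : ℝ) :
    spectralSubspace T {e} = eigenspace T e := by
  have h1 : {φ : E | spectralMeasure T φ {e}ᶜ = 0} = (eigenspace T e : Set E) := by
    ext φ; exact (mem_eigenspace_iff_spectralMeasure hT).symm
  rw [spectralSubspace, h1, Submodule.span_eq]
  refine IsClosed.submodule_topologicalClosure_eq ?_
  have : (eigenspace T e : Set E) = {φ | T φ = (e : ℂ) • φ} := by
    ext φ; exact mem_eigenspace
  rw [this]
  exact isClosed_eq T.continuous (continuous_const_smul _)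

theorem spectralProjection_singleton_mem (hT : IsSelfAdjoint T) (e : ℝ) (φ : E) :
    spectralProjection T {e} φ ∈ eigenspace T e := by
  rw [← spectralSubspace_singleton hT]
  exact Submodule.starProjection_apply_mem _ φ

/-! ### The pure point subspace -/

/-- The closed linear span of the eigenvectors of `T`. -/
def eigenvectorSpan (T : E →L[ℂ] E) : Submodule ℂ E :=
  (⨆ e : ℝ, eigenspace T e).topologicalClosure

instance (T : E →L[ℂ] E) : CompleteSpace (eigenvectorSpan T) :=
  inferInstanceAs (CompleteSpace (⨆ e : ℝ, eigenspace T e).topologicalClosure)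

theorem eigenspace_le_eigenvectorSpan (T : E →L[ℂ] E) (e : ℝ) :
    eigenspace T e ≤ eigenvectorSpan T :=
  (le_iSup (fun e : ℝ => eigenspace T e) e).trans (Submodule.le_topologicalClosure _)

theorem mem_orthogonal_eigenvectorSpan {ψ : E} :
    ψ ∈ (eigenvectorSpan T)ᗮ ↔ ∀ e : ℝ, ∀ φ ∈ eigenspace T e, inner ℂ φ ψ = 0 := by
  rw [eigenvectorSpan, Submodule.orthogonal_closure, ← Submodule.iInf_orthogonal]
  simp [Submodule.mem_orthogonal]

theorem mem_orthogonal_eigenvectorSpan_iff_spectralMeasure (hT : IsSelfAdjoint T) {ψ : E} :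
    ψ ∈ (eigenvectorSpan T)ᗮ ↔ ∀ e, spectralMeasure T ψ {e} = 0 := by
  rw [mem_orthogonal_eigenvectorSpan]
  constructor
  · intro h e
    exact spectralMeasure_eq_zero_of_inner hT (measurableSet_singleton e)
      (h e _ (spectralProjection_singleton_mem hT e ψ))
  · intro h e φ hφ
    exact inner_eq_zero_of_spectralMeasure hT (measurableSet_singleton e)
      ((mem_eigenspace_iff_spectralMeasure hT).1 hφ) (h e)

theorem mem_eigenvectorSpan_iff (T : E →L[ℂ] E) (φ : E) :
    φ ∈ eigenvectorSpan T ↔ ∀ ψ ∈ (eigenvectorSpan T)ᗮ, inner ℂ ψ φ = 0 := by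
  conv_lhs => rw [← Submodule.orthogonal_orthogonal (eigenvectorSpan T)]
  rw [Submodule.mem_orthogonal]

theorem mem_eigenvectorSpan_iff_isPurePoint (hT : IsSelfAdjoint T) {φ : E} :
    φ ∈ eigenvectorSpan T ↔ IsPurePoint (spectralMeasure T φ) := by
  constructor
  · intro hφ
    -- `S` is the set of atoms. The projection of `φ` to `Sᶜ` has an atomless spectral measure,
    -- hence is orthogonal to all eigenvectors and so to `φ`.
    let S : Set ℝ := {e | 0 < spectralMeasure T φ {e}}
    have hS : S.Countable := Measure.countable_meas_pos_of_disjoint_iUnion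
      (fun e : ℝ => measurableSet_singleton e)
      (fun a b hab => Set.disjoint_singleton.2 hab)
    refine ⟨S, hS, spectralMeasure_eq_zero_of_inner hT hS.measurableSet.compl ?_⟩
    refine (mem_eigenvectorSpan_iff T φ).1 hφ _ ?_
    rw [mem_orthogonal_eigenvectorSpan_iff_spectralMeasure hT]
    intro e
    rw [spectralMeasure_spectralProjection hT hS.measurableSet.compl,
      Measure.restrict_apply (measurableSet_singleton e)]
    by_cases he : e ∈ S
    · have : ({e} : Set ℝ) ∩ Sᶜ = ∅ := by
        ext x; simp only [Set.mem_inter_iff, Set.mem_singleton_iff]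
        constructor
        · rintro ⟨rfl, h⟩; exact h he
        · exact fun h => h.elim
      rw [this, measure_empty]
    · exact measure_mono_null Set.inter_subset_left (by simpa [S] using he)
  · rintro ⟨S, hS, h⟩
    -- The spectral measure of `ψ` has no atoms, so it does not charge the countable set carrying
    -- that of `φ`. Thus `ψ` is orthogonal to `φ`, and then to itself.
    let ψ := φ - (eigenvectorSpan T).starProjection φ
    have hψ : ψ ∈ (eigenvectorSpan T)ᗮ := Submodule.sub_starProjection_mem_orthogonal φ
    have h0 : spectralMeasure T ψ S = 0 := by
      rw [← Set.biUnion_of_singleton S]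
      exact (measure_biUnion_null_iff hS).2 fun e _ =>
        (mem_orthogonal_eigenvectorSpan_iff_spectralMeasure hT).1 hψ e
    have h1 : inner ℂ φ ψ = 0 := inner_eq_zero_of_spectralMeasure hT hS.measurableSet h h0
    have h2 : inner ℂ ((eigenvectorSpan T).starProjection φ) ψ = 0 :=
      (Submodule.mem_orthogonal _ _).1 hψ _ (Submodule.starProjection_apply_mem _ φ)
    have h3 : inner ℂ ψ ψ = 0 := by
      conv_lhs => enter [2]; rw [show ψ = φ - (eigenvectorSpan T).starProjection φ from rfl]
      rw [inner_sub_left, h1, h2, sub_zero]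
    have h4 : φ = (eigenvectorSpan T).starProjection φ := sub_eq_zero.1 (inner_self_eq_zero.1 h3)
    rw [h4]
    exact Submodule.starProjection_apply_mem _ φ

theorem purePointSpace_eq (hT : IsSelfAdjoint T) :
    purePointSpace T = (eigenvectorSpan T : Set E) := by
  ext φ
  exact (mem_eigenvectorSpan_iff_isPurePoint hT).symm

theorem apply_mem_orthogonal_eigenvectorSpan (hT : IsSelfAdjoint T) {ψ : E}
    (hψ : ψ ∈ (eigenvectorSpan T)ᗮ) : T ψ ∈ (eigenvectorSpan T)ᗮ := by
  rw [mem_orthogonal_eigenvectorSpan] at hψ ⊢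
  intro e φ hφ
  have h := ContinuousLinearMap.isSelfAdjoint_iff_isSymmetric.1 hT φ ψ
  calc inner ℂ φ (T ψ) = inner ℂ (T φ) ψ := h.symm
    _ = 0 := by rw [mem_eigenspace.1 hφ, inner_smul_left, hψ e φ hφ, mul_zero]

theorem apply_mem_eigenvectorSpan (hT : IsSelfAdjoint T) {φ : E}
    (hφ : φ ∈ eigenvectorSpan T) : T φ ∈ eigenvectorSpan T := by
  rw [mem_eigenvectorSpan_iff] at hφ ⊢
  intro ψ hψ
  have h := ContinuousLinearMap.isSelfAdjoint_iff_isSymmetric.1 hT ψ φ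
  exact h.symm.trans (hφ _ (apply_mem_orthogonal_eigenvectorSpan hT hψ))

theorem notMem_spectrum_iff_bijective (T : E →L[ℂ] E) (e : ℝ) :
    e ∉ spectrum ℝ T ↔ Function.Bijective fun φ => T φ - (e : ℂ) • φ := by
  rw [spectrum.notMem_iff, IsUnit.sub_iff, ContinuousLinearMap.isUnit_iff_bijective]
  have : ⇑(T - algebraMap ℝ (E →L[ℂ] E) e) = fun φ => T φ - (e : ℂ) • φ := by
    ext φ
    simp [Algebra.algebraMap_eq_smul_one]
  rw [this]

/-- The span of the eigenvectors and its orthogonal complement are both invariant. On the complement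
the spectral measures miss a neighbourhood of `e`, so `T - e` is onto there; only the pure point
part can obstruct bijectivity. -/
theorem spectrum_inter_interior (hT : IsSelfAdjoint T) {I : Set ℝ}
    (h : ∀ ψ ∈ (eigenvectorSpan T)ᗮ, spectralMeasure T ψ I = 0) :
    spectrum ℝ T ∩ interior I = purePointSpectrum T ∩ interior I := by
  have hmaps : ∀ e : ℝ, ∀ φ ∈ eigenvectorSpan T, T φ - (e : ℂ) • φ ∈ eigenvectorSpan T :=
    fun e φ hφ => Submodule.sub_mem _ (apply_mem_eigenvectorSpan hT hφ)
      (Submodule.smul_mem _ _ hφ)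
  have hmaps' : ∀ e : ℝ, ∀ φ ∈ (eigenvectorSpan T)ᗮ,
      T φ - (e : ℂ) • φ ∈ (eigenvectorSpan T)ᗮ :=
    fun e φ hφ => Submodule.sub_mem _ (apply_mem_orthogonal_eigenvectorSpan hT hφ)
      (Submodule.smul_mem _ _ hφ)
  ext e
  rw [Set.mem_inter_iff, Set.mem_inter_iff]
  refine and_congr_left fun he => ?_
  rw [← not_iff_not, notMem_spectrum_iff_bijective]
  simp only [purePointSpectrum, purePointSpace_eq hT, Set.mem_ofPred_eq, not_not]
  have hdec : ∀ ξ : E, ∃ u ∈ eigenvectorSpan T, ∃ v ∈ (eigenvectorSpan T)ᗮ, ξ = u + v :=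
    fun ξ => ⟨_, Submodule.starProjection_apply_mem _ ξ, _,
      Submodule.sub_starProjection_mem_orthogonal ξ, by abel⟩
  constructor
  · intro hb
    refine ⟨fun φ hφ => hmaps e φ hφ, hb.1.injOn, fun η hη => ?_⟩
    obtain ⟨ξ, hξ⟩ := hb.2 η
    obtain ⟨u, hu, v, hv, rfl⟩ := hdec ξ
    refine ⟨u, hu, ?_⟩
    simp only at hξ ⊢
    have h1 : T v - (e : ℂ) • v = η - (T u - (e : ℂ) • u) := by
      rw [← hξ, map_add, smul_add]; abel
    have h2 : T v - (e : ℂ) • v ∈ eigenvectorSpan T := by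
      rw [h1]; exact Submodule.sub_mem _ hη (hmaps e u hu)
    have h3 : T v - (e : ℂ) • v = 0 :=
      inner_self_eq_zero.1 ((Submodule.mem_orthogonal _ _).1 (hmaps' e v hv) _ h2)
    rw [h3] at h1
    exact (sub_eq_zero.1 h1.symm).symm
  · intro hb
    refine ⟨fun φ ψ hφψ => ?_, fun η => ?_⟩
    · simp only at hφψ
      have h1 : φ - ψ ∈ eigenspace T e := by
        rw [mem_eigenspace, map_sub, smul_sub, sub_eq_sub_iff_sub_eq_sub]
        exact hφψ
      have h2 : φ - ψ = 0 := hb.2.1 (eigenspace_le_eigenvectorSpan T e h1)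
        (Submodule.zero_mem _) (by simp [mem_eigenspace.1 h1])
      exact sub_eq_zero.1 h2
    · obtain ⟨u, hu, v, hv, rfl⟩ := hdec η
      obtain ⟨u', -, hu'⟩ := hb.2.2 hu
      obtain ⟨κ, hκ, hball⟩ := Metric.isOpen_iff.1 isOpen_interior e he
      -- A continuous function on all of `ℝ` that equals `1 / (x - e)` where `|x - e| ≥ κ`, that is,
      -- almost everywhere for the spectral measure of `v`.
      let g : ℝ → ℂ := fun x => (((x - e) / max ((x - e) ^ 2) (κ ^ 2) : ℝ) : ℂ)
      have hg : Continuous g := by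
        refine Complex.continuous_ofReal.comp (Continuous.div (by fun_prop) (by fun_prop) ?_)
        intro x
        have : 0 < max ((x - e) ^ 2) (κ ^ 2) := lt_max_of_lt_right (by positivity)
        exact this.ne'
      have hgv : T (fc T g v) - (e : ℂ) • fc T g v = v := by
        have h1 : ‖fc T (fun x => ((x : ℂ) - e) * g x - 1) v‖ ^ 2 = 0 := by
          rw [norm_fc_sq hT v (by fun_prop)]
          refine integral_eq_zero_of_ae ?_
          filter_upwards [measure_eq_zero_iff_ae_notMem.1 (h v hv)] with x hx
          have hx1 : κ ≤ |x - e| := by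
            by_contra hlt
            refine hx (interior_subset (hball ?_))
            rw [Metric.mem_ball, Real.dist_eq]
            exact not_le.1 hlt
          have hx2 : κ ^ 2 ≤ (x - e) ^ 2 := by
            rw [← sq_abs (x - e)]; gcongr
          have hx3 : x - e ≠ 0 := by
            intro h0; rw [h0, abs_zero] at hx1; linarith
          have hx4 : (x - e) * ((x - e) / max ((x - e) ^ 2) (κ ^ 2)) = 1 := by
            rw [max_eq_left hx2]; field_simp
          have hx5 : ((x : ℂ) - e) * g x = 1 := by
            simp only [g]
            rw [← Complex.ofReal_sub, ← Complex.ofReal_mul, hx4, Complex.ofReal_one]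
          simp [hx5]
        have h2 : fc T (fun x => ((x : ℂ) - e) * g x - 1) v = 0 := by
          rwa [sq_eq_zero_iff, norm_eq_zero] at h1
        rw [fc_sub T (by fun_prop) (by fun_prop), fc_mul T (by fun_prop) hg,
          fc_sub T (by fun_prop) (by fun_prop), fc_id hT, fc_const hT, fc_const hT] at h2
        simpa [sub_eq_zero] using h2
      refine ⟨u' + fc T g v, ?_⟩
      simp only at hu' ⊢
      rw [map_add, smul_add, add_sub_add_comm, hu', hgv]

end SpectralTheory

/-! ### Time averages -/

theorem tendsto_average_pow {z : ℂ} (hz : ‖z‖ = 1) (hz1 : z ≠ 1) :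
    Tendsto (fun N : ℕ => (N : ℂ)⁻¹ * ∑ n ∈ Finset.range N, z ^ n) atTop (𝓝 0) := by
  have h0 : Tendsto (fun N : ℕ => (N : ℝ)⁻¹ * (2 / ‖z - 1‖)) atTop (𝓝 0) := by
    simpa using (tendsto_inv_atTop_nhds_zero_nat (𝕜 := ℝ)).mul_const (2 / ‖z - 1‖)
  refine squeeze_zero_norm (fun N => ?_) h0
  rw [geom_sum_eq hz1, norm_mul, norm_inv, Complex.norm_natCast, norm_div]
  gcongr
  refine (norm_sub_le _ _).trans ?_
  rw [norm_pow, hz]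
  norm_num

theorem norm_average_le {F : Type*} [SeminormedAddCommGroup F] [NormedSpace ℂ F] (N : ℕ)
    {a : ℕ → F} {M : ℝ} (hM : 0 ≤ M) (h : ∀ n, ‖a n‖ ≤ M) :
    ‖(N : ℂ)⁻¹ • ∑ n ∈ Finset.range N, a n‖ ≤ M := by
  rw [norm_smul, norm_inv, Complex.norm_natCast]
  have h1 : ‖∑ n ∈ Finset.range N, a n‖ ≤ N * M := by
    simpa using norm_sum_le_of_le (Finset.range N) fun n _ => h n
  rcases Nat.eq_zero_or_pos N with rfl | hN
  · simpa using hM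
  · have : (0 : ℝ) < N := by exact_mod_cast hN
    rw [inv_mul_le_iff₀ this]
    exact h1

theorem exp_neg_I_mul_ne_one {θ : ℝ} (h0 : θ ≠ 0) (h1 : |θ| ≤ 1) :
    Complex.exp (-(Complex.I * θ)) ≠ 1 := by
  intro h
  obtain ⟨n, hn⟩ := Complex.exp_eq_one_iff.1 h
  have h2 : θ = -(n * (2 * Real.pi)) := by
    have := congrArg Complex.im hn
    simp at this
    linarith
  have hn0 : n ≠ 0 := by
    rintro rfl; simp at h2; exact h0 h2
  have hn1 : (1 : ℝ) ≤ |(n : ℝ)| := by exact_mod_cast Int.one_le_abs hn0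
  rw [h2, abs_neg, abs_mul, abs_of_pos Real.two_pi_pos] at h1
  nlinarith [Real.pi_gt_three]

section SpectralTheory

variable {E : Type*} [NormedAddCommGroup E] [InnerProductSpace ℂ E] [CompleteSpace E]
variable {T : E →L[ℂ] E}

theorem exists_spectrum_bound (T : E →L[ℂ] E) : ∃ M : ℝ, 0 ≤ M ∧ ∀ x ∈ spectrum ℝ T, |x| ≤ M := by
  obtain ⟨M, hM⟩ := (spectrum.isCompact (𝕜 := ℝ) T).isBounded.exists_norm_le
  exact ⟨max M 0, le_max_right _ _, fun x hx => (hM x hx).trans (le_max_left _ _)⟩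

theorem inner_evolution_evolution (hT : IsSelfAdjoint T) (s t : ℝ) (φ ψ : E) :
    inner ℂ (evolution T s φ) (evolution T t ψ) = inner ℂ φ (evolution T (t - s) ψ) := by
  simp only [evolution_eq_fc hT]
  rw [inner_fc_left, ← mul_apply_eq_comp, ← fc_mul T (by fun_prop) (by fun_prop)]
  congr 3
  ext x
  rw [← Complex.exp_conj, ← Complex.exp_add]
  congr 1
  simp
  ring

theorem evolution_zero (T : E →L[ℂ] E) : evolution T 0 = 1 := by
  simp [evolution]

theorem norm_evolution (hT : IsSelfAdjoint T) (t : ℝ) (φ : E) : ‖evolution T t φ‖ = ‖φ‖ := by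
  have h := inner_evolution_evolution hT t t φ φ
  rw [sub_self, evolution_zero, one_apply_eq_self, inner_self_eq_norm_sq_to_K,
    inner_self_eq_norm_sq_to_K] at h
  have h' : ‖evolution T t φ‖ ^ 2 = ‖φ‖ ^ 2 := Complex.ofReal_injective (by simpa using h)
  exact (sq_eq_sq₀ (norm_nonneg _) (norm_nonneg _)).1 h'

theorem spectralProjection_eq_zero {S : Set ℝ} {φ : E} (h : φ ∈ (spectralSubspace T S)ᗮ) :
    spectralProjection T S φ = 0 :=
  Submodule.starProjection_apply_eq_zero_iff _ |>.2 h

/-- The projection to an eigenspace is a time average of the evolution. -/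
theorem exists_tendsto_average_evolution (hT : IsSelfAdjoint T) (e : ℝ) (φ : E) :
    ∃ τ : ℝ, Tendsto (fun N : ℕ => (N : ℂ)⁻¹ • ∑ n ∈ Finset.range N,
      Complex.exp (Complex.I * (n * τ * e : ℝ)) • evolution T (n * τ) φ) atTop
      (𝓝 (spectralProjection T {e} φ)) := by
  obtain ⟨M, hM0, hM⟩ := exists_spectrum_bound T
  have hpos : 0 < M + |e| + 1 := by positivity
  -- The time step is so short that `|τ (x - e)| ≤ 1` on the spectrum. Hence `w x = 1` there only at
  -- `x = e`, and sampling at discrete times does not confuse `e` with other energies.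
  let τ : ℝ := (M + |e| + 1)⁻¹
  have hτ : 0 < τ := inv_pos.2 hpos
  refine ⟨τ, ?_⟩
  let w : ℝ → ℂ := fun x => Complex.exp (-(Complex.I * (τ * (x - e) : ℝ)))
  have hw : Continuous w := by fun_prop
  have hwn : ∀ x, ‖w x‖ = 1 := fun x => by
    simp only [w]
    rw [Complex.norm_exp]
    simp
  let g : ℕ → ℝ → ℂ := fun N x => (N : ℂ)⁻¹ * ∑ n ∈ Finset.range N, w x ^ n
  have hg : ∀ N, Continuous (g N) := fun N => by fun_prop
  have hgb : ∀ N x, ‖g N x‖ ≤ 1 := fun N x =>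
    norm_average_le N zero_le_one fun n => by rw [norm_pow, hwn, one_pow]
  have hsum : ∀ N : ℕ, fc T (g N) φ = (N : ℂ)⁻¹ • ∑ n ∈ Finset.range N,
      Complex.exp (Complex.I * (n * τ * e : ℝ)) • evolution T (n * τ) φ := by
    intro N
    rw [fc_const_mul T _ (by fun_prop), fc_sum T _ (fun n => by fun_prop), smul_apply,
      sum_apply]
    congr 1
    refine Finset.sum_congr rfl fun n _ => ?_
    rw [evolution_eq_fc hT, ← smul_apply, ← fc_const_mul T _ (by fun_prop)]
    congr 2
    ext x
    simp only [w]
    rw [← Complex.exp_nat_mul, ← Complex.exp_add]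
    congr 1
    push_cast
    ring
  have hsplit : φ = spectralProjection T {e} φ + (φ - spectralProjection T {e} φ) := by abel
  have h1 : Tendsto (fun N => fc T (g N) (φ - spectralProjection T {e} φ)) atTop (𝓝 0) := by
    refine tendsto_fc_zero hT _ hg hgb ?_
    have h2 : spectralMeasure T (φ - spectralProjection T {e} φ) {e} = 0 := by
      refine spectralMeasure_eq_zero_of_inner hT (measurableSet_singleton e) ?_
      rw [spectralProjection_eq_zero, inner_zero_left]
      exact Submodule.sub_starProjection_mem_orthogonal φ
    filter_upwards [ae_mem_spectrum T (φ - spectralProjection T {e} φ),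
      measure_eq_zero_iff_ae_notMem.1 h2] with x hx hxe
    refine tendsto_average_pow (hwn x) (exp_neg_I_mul_ne_one ?_ ?_)
    · exact mul_ne_zero hτ.ne' (sub_ne_zero.2 hxe)
    · rw [abs_mul, abs_of_pos hτ, inv_mul_le_iff₀ hpos, mul_one]
      linarith [abs_sub x e, hM x hx]
  have h2 : Tendsto (fun N => fc T (fun x => g N x - 1) (spectralProjection T {e} φ)) atTop
      (𝓝 0) := by
    refine tendsto_fc_zero hT _ (M := 2) (fun N => by fun_prop) (fun N x => ?_) ?_
    · refine (norm_sub_le _ _).trans ?_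
      rw [norm_one]; linarith [hgb N x]
    · filter_upwards [measure_eq_zero_iff_ae_notMem.1 ((mem_eigenspace_iff_spectralMeasure hT).1
        (spectralProjection_singleton_mem hT e φ))] with x hx
      have hx : x = e := by simpa using hx
      refine tendsto_const_nhds.congr' ?_
      filter_upwards [eventually_ge_atTop 1] with N hN
      have : (N : ℂ) ≠ 0 := by exact_mod_cast (by omega : N ≠ 0)
      simp [g, w, hx, this]
  have h3 := (h2.add h1).add_const (spectralProjection T {e} φ)
  rw [add_zero, zero_add] at h3
  refine h3.congr fun N => ?_
  rw [fc_sub T (hg N) (by fun_prop), fc_const hT, ← hsum]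
  conv_rhs => rw [hsplit, map_add]
  simp

theorem spectralProjection_singleton_comp (hT : IsSelfAdjoint T) {I : Set ℝ} {e : ℝ}
    (he : e ∈ I) (φ : E) :
    spectralProjection T {e} (spectralProjection T I φ) = spectralProjection T {e} φ := by
  have h : spectralProjection T {e} (φ - spectralProjection T I φ) = 0 := by
    refine spectralProjection_eq_zero (Submodule.orthogonal_le (fun η hη => ?_)
      (Submodule.sub_starProjection_mem_orthogonal φ))
    rw [spectralSubspace_singleton hT] at hη
    refine mem_spectralSubspace (measure_mono_null ?_
      ((mem_eigenspace_iff_spectralMeasure hT).1 hη))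
    exact Set.compl_subset_compl.2 (Set.singleton_subset_iff.2 he)
  rw [map_sub, sub_eq_zero] at h
  exact h.symm

/-- The matrix element is a limit of averages of the dynamical ones multiplied by phases, so a bound
uniform in time survives. -/
theorem norm_inner_spectralProjection_singleton_le (hT : IsSelfAdjoint T) {I : Set ℝ} {e : ℝ}
    (he : e ∈ I) {φ η : E} {q : ℝ}
    (hq : ∀ t, ‖inner ℂ η (evolution T t (spectralProjection T I φ))‖ ≤ q) :
    ‖inner ℂ η (spectralProjection T {e} φ)‖ ≤ q := by
  rw [← spectralProjection_singleton_comp hT he]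
  obtain ⟨τ, hτ⟩ := exists_tendsto_average_evolution hT e (spectralProjection T I φ)
  refine le_of_tendsto ((tendsto_const_nhds (x := η)).inner (𝕜 := ℂ) hτ).norm
    (Eventually.of_forall fun N => ?_)
  rw [inner_smul_right, inner_sum, ← smul_eq_mul]
  refine norm_average_le N ((norm_nonneg _).trans (hq 0)) fun n => ?_
  rw [inner_smul_right, norm_mul, Complex.norm_exp]
  simpa using hq (n * τ)

/-- Wiener's lemma for the spectral measure of a vector orthogonal to all eigenvectors. -/
theorem exists_tendsto_average_norm_inner_sq (hT : IsSelfAdjoint T) {ψ : E}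
    (hψ : ψ ∈ (eigenvectorSpan T)ᗮ) :
    ∃ τ : ℝ, Tendsto (fun N : ℕ => (N : ℝ)⁻¹ * ∑ n ∈ Finset.range N,
      ‖inner ℂ ψ (evolution T (n * τ) ψ)‖ ^ 2) atTop (𝓝 0) := by
  obtain ⟨M, hM0, hM⟩ := exists_spectrum_bound T
  have hpos : 0 < M + M + 1 := by positivity
  -- Two points of the spectrum differ by at most `2M`, so `w = 1` only on the diagonal.
  let τ : ℝ := (M + M + 1)⁻¹
  have hτ : 0 < τ := inv_pos.2 hpos
  refine ⟨τ, ?_⟩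
  set μ := spectralMeasure T ψ
  let w : ℝ × ℝ → ℂ := fun p => Complex.exp (-(Complex.I * (τ * (p.1 - p.2) : ℝ)))
  have hw : Continuous w := by fun_prop
  have hwn : ∀ p, ‖w p‖ = 1 := fun x => by
    simp only [w]
    rw [Complex.norm_exp]
    simp
  -- The squared Fourier transform of `μ` is a double integral. Its time average tends to the `μ ×
  -- μ`-mass of the diagonal, which is zero since `μ` has no atoms.
  have hone : ∀ n : ℕ, ((‖inner ℂ ψ (evolution T (n * τ) ψ)‖ ^ 2 : ℝ) : ℂ) =
      ∫ p, w p ^ n ∂(μ.prod μ) := by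
    intro n
    have h1 : inner ℂ ψ (evolution T (n * τ) ψ) =
        ∫ x : ℝ, Complex.exp (-(Complex.I * (n * τ : ℝ)) * x) ∂μ := by
      rw [evolution_eq_fc hT, inner_fc hT ψ (by fun_prop)]
    rw [Complex.ofReal_pow, ← Complex.mul_conj', h1, ← integral_conj, ← integral_prod_mul]
    congr 1
    ext p
    rw [← Complex.exp_conj, ← Complex.exp_add, ← Complex.exp_nat_mul]
    congr 1
    simp
    ring
  have hlim : Tendsto (fun N : ℕ => ∫ p, (N : ℂ)⁻¹ * ∑ n ∈ Finset.range N, w p ^ n ∂(μ.prod μ))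
      atTop (𝓝 (∫ _, (0 : ℂ) ∂(μ.prod μ))) := by
    refine tendsto_integral_of_dominated_convergence (fun _ => 1)
      (fun N => (by fun_prop : Continuous _).aestronglyMeasurable) (integrable_const _)
      (fun N => Eventually.of_forall fun p =>
        norm_average_le N zero_le_one fun n => by rw [norm_pow, hwn, one_pow]) ?_
    have hd : ∀ᵐ p ∂(μ.prod μ), p.1 ≠ p.2 := by
      have hm : MeasurableSet {p : ℝ × ℝ | p.1 = p.2} := measurableSet_eq_fun measurable_fst
        measurable_snd
      have : (μ.prod μ) {p : ℝ × ℝ | p.1 = p.2} = 0 := by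
        rw [Measure.measure_prod_null hm]
        refine Eventually.of_forall fun x => ?_
        have h2 : Prod.mk x ⁻¹' {p : ℝ × ℝ | p.1 = p.2} = {x} := by
          ext y; simp [eq_comm]
        simp only [h2]
        exact (mem_orthogonal_eigenvectorSpan_iff_spectralMeasure hT).1 hψ x
      exact measure_eq_zero_iff_ae_notMem.1 this
    filter_upwards [hd, Measure.quasiMeasurePreserving_fst.ae (ae_mem_spectrum T ψ),
      Measure.quasiMeasurePreserving_snd.ae (ae_mem_spectrum T ψ)] with p hp h1 h2
    refine tendsto_average_pow (hwn p) (exp_neg_I_mul_ne_one ?_ ?_)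
    · exact mul_ne_zero hτ.ne' (sub_ne_zero.2 hp)
    · rw [abs_mul, abs_of_pos hτ, inv_mul_le_iff₀ hpos, mul_one]
      linarith [abs_sub p.1 p.2, hM _ h1, hM _ h2]
  rw [integral_zero] at hlim
  have h4 := (Complex.continuous_re.tendsto _).comp hlim
  refine h4.congr fun N => ?_
  have h5 : ∫ p, (N : ℂ)⁻¹ * ∑ n ∈ Finset.range N, w p ^ n ∂(μ.prod μ) =
      (((N : ℝ)⁻¹ * ∑ n ∈ Finset.range N, ‖inner ℂ ψ (evolution T (n * τ) ψ)‖ ^ 2 : ℝ) : ℂ) := by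
    rw [integral_const_mul, integral_finsetSum]
    · push_cast [← hone]; rfl
    · intro n _
      exact Integrable.of_bound (hw.pow n).aestronglyMeasurable 1
        (Eventually.of_forall fun p => by rw [norm_pow, hwn, one_pow])
  simp only [Function.comp_apply]
  rw [h5, Complex.ofReal_re]

theorem tendsto_average_of_tendsto_average_sq {a : ℕ → ℝ} (ha : ∀ n, 0 ≤ a n)
    (h : Tendsto (fun N : ℕ => (N : ℝ)⁻¹ * ∑ n ∈ Finset.range N, a n ^ 2) atTop (𝓝 0)) :
    Tendsto (fun N : ℕ => (N : ℝ)⁻¹ * ∑ n ∈ Finset.range N, a n) atTop (𝓝 0) := by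
  have h1 := h.sqrt
  rw [Real.sqrt_zero] at h1
  refine squeeze_zero (fun N => mul_nonneg (by positivity) (Finset.sum_nonneg fun n _ => ha n))
    (fun N => ?_) h1
  refine Real.le_sqrt_of_sq_le ?_
  have h2 := sq_sum_le_card_mul_sum_sq (s := Finset.range N) (f := a)
  rw [Finset.card_range] at h2
  rcases Nat.eq_zero_or_pos N with rfl | hN
  · simp
  · have hN' : (0 : ℝ) < N := by exact_mod_cast hN
    calc ((N : ℝ)⁻¹ * ∑ n ∈ Finset.range N, a n) ^ 2
        = (N : ℝ)⁻¹ ^ 2 * (∑ n ∈ Finset.range N, a n) ^ 2 := by ring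
      _ ≤ (N : ℝ)⁻¹ ^ 2 * (N * ∑ n ∈ Finset.range N, a n ^ 2) := by gcongr
      _ = (N : ℝ)⁻¹ * ∑ n ∈ Finset.range N, a n ^ 2 := by field_simp

theorem tendsto_average_of_shift {a : ℕ → ℝ} (ha : ∀ n, 0 ≤ a n) (k : ℕ)
    (h : Tendsto (fun N : ℕ => (N : ℝ)⁻¹ * ∑ n ∈ Finset.range N, a (k + n)) atTop (𝓝 0)) :
    Tendsto (fun N : ℕ => (N : ℝ)⁻¹ * ∑ n ∈ Finset.range N, a n) atTop (𝓝 0) := by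
  have h1 := ((tendsto_inv_atTop_nhds_zero_nat (𝕜 := ℝ)).mul_const
    (∑ n ∈ Finset.range k, a n)).add h
  rw [zero_mul, add_zero] at h1
  refine squeeze_zero (fun N => mul_nonneg (by positivity) (Finset.sum_nonneg fun n _ => ha n))
    (fun N => ?_) h1
  rw [← mul_add, ← Finset.sum_range_add]
  gcongr
  · exact fun i _ _ => ha i
  · omega

/-- The vectors `η` for which the overlap with the orbit `v` vanishes on average. -/
def averageZeroSubmodule (v : ℕ → E) : Submodule ℂ E where
  carrier := {η | Tendsto (fun N : ℕ => (N : ℝ)⁻¹ * ∑ n ∈ Finset.range N, ‖inner ℂ η (v n)‖)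
    atTop (𝓝 0)}
  zero_mem' := by simp
  add_mem' := by
    intro η η' h h'
    have h1 := Tendsto.add h h'
    rw [add_zero] at h1
    refine squeeze_zero (fun N => by positivity) (fun N => ?_) h1
    rw [← mul_add, ← Finset.sum_add_distrib]
    gcongr with n _
    rw [inner_add_left]
    exact norm_add_le _ _
  smul_mem' := by
    intro r η h
    have h1 := Tendsto.const_mul ‖r‖ h
    rw [mul_zero] at h1
    refine h1.congr fun N => ?_
    simp only [inner_smul_left, norm_mul, RCLike.norm_conj, ← Finset.mul_sum]
    ring

theorem isClosed_averageZeroSubmodule {v : ℕ → E} {M : ℝ} (hM : ∀ n, ‖v n‖ ≤ M) :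
    IsClosed (averageZeroSubmodule v : Set E) := by
  refine isClosed_of_closure_subset fun η hη => ?_
  have hM0 : 0 ≤ M := (norm_nonneg _).trans (hM 0)
  refine Metric.tendsto_atTop.2 fun ε hε => ?_
  obtain ⟨η', hη', hd⟩ := Metric.mem_closure_iff.1 hη (ε / 2 / (M + 1)) (by positivity)
  obtain ⟨N₀, hN₀⟩ := Metric.tendsto_atTop.1 hη' (ε / 2) (by positivity)
  refine ⟨N₀, fun N hN => ?_⟩
  have h1 := hN₀ N hN
  rw [Real.dist_0_eq_abs, abs_of_nonneg (by positivity)] at h1 ⊢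
  have h2 : (N : ℝ)⁻¹ * ∑ n ∈ Finset.range N, ‖inner ℂ (η - η') (v n)‖ ≤ ε / 2 := by
    have h3 : ∑ n ∈ Finset.range N, ‖inner ℂ (η - η') (v n)‖ ≤ N * (ε / 2) := by
      rw [← nsmul_eq_mul, ← Finset.card_range N, ← Finset.sum_const, Finset.card_range]
      refine Finset.sum_le_sum fun n _ => (norm_inner_le_norm _ _).trans ?_
      rw [dist_eq_norm] at hd
      calc ‖η - η'‖ * ‖v n‖ ≤ ε / 2 / (M + 1) * (M + 1) := by
            gcongr
            linarith [hM n]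
        _ = ε / 2 := by field_simp
    rcases Nat.eq_zero_or_pos N with rfl | hN
    · simp; positivity
    · have : (0 : ℝ) < N := by exact_mod_cast hN
      rw [inv_mul_le_iff₀ this]
      exact h3
  calc (N : ℝ)⁻¹ * ∑ n ∈ Finset.range N, ‖inner ℂ η (v n)‖
      ≤ (N : ℝ)⁻¹ * ∑ n ∈ Finset.range N, ‖inner ℂ (η - η') (v n)‖ +
        (N : ℝ)⁻¹ * ∑ n ∈ Finset.range N, ‖inner ℂ η' (v n)‖ := by
        rw [← mul_add, ← Finset.sum_add_distrib]
        gcongr with n _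
        rw [show inner ℂ η (v n) = inner ℂ (η - η') (v n) + inner ℂ η' (v n) by
          rw [inner_sub_left]; ring]
        exact norm_add_le _ _
    _ < ε := by linarith

/-- Wiener's lemma is the case `η = ψ`. Unitarity and a time shift give it for `η` on the orbit,
linearity and closedness for the closed span of the orbit, and a vector orthogonal to the orbit
contributes nothing. -/
theorem exists_tendsto_average_norm_inner (hT : IsSelfAdjoint T) {ψ : E}
    (hψ : ψ ∈ (eigenvectorSpan T)ᗮ) :
    ∃ τ : ℝ, ∀ η, Tendsto (fun N : ℕ => (N : ℝ)⁻¹ * ∑ n ∈ Finset.range N,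
      ‖inner ℂ η (evolution T (n * τ) ψ)‖) atTop (𝓝 0) := by
  obtain ⟨τ, hτ⟩ := exists_tendsto_average_norm_inner_sq hT hψ
  refine ⟨τ, fun η => ?_⟩
  have h0 := tendsto_average_of_tendsto_average_sq (fun n => norm_nonneg _) hτ
  let v : ℕ → E := fun n => evolution T (n * τ) ψ
  let W : Submodule ℂ E := (Submodule.span ℂ (Set.range v)).topologicalClosure
  have : CompleteSpace W :=
    inferInstanceAs (CompleteSpace (Submodule.span ℂ (Set.range v)).topologicalClosure)
  have hW : W ≤ averageZeroSubmodule v := by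
    refine Submodule.topologicalClosure_minimal _ (Submodule.span_le.2 ?_)
      (isClosed_averageZeroSubmodule (M := ‖ψ‖) fun n => (norm_evolution hT _ ψ).le)
    rintro _ ⟨k, rfl⟩
    refine tendsto_average_of_shift (fun n => norm_nonneg _) k (h0.congr fun N => ?_)
    congr 1
    refine Finset.sum_congr rfl fun n _ => ?_
    simp only [v]
    rw [inner_evolution_evolution hT]
    congr 4
    push_cast; ring
  have h1 : W.starProjection η ∈ averageZeroSubmodule v :=
    hW (Submodule.starProjection_apply_mem _ η)
  refine Tendsto.congr (fun N => ?_) h1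
  congr 1
  refine Finset.sum_congr rfl fun n _ => ?_
  have h2 : inner ℂ (η - W.starProjection η) (v n) = 0 :=
    (Submodule.mem_orthogonal' _ _).1 (Submodule.sub_starProjection_mem_orthogonal η) _
      (Submodule.le_topologicalClosure _ (Submodule.subset_span ⟨n, rfl⟩))
  rw [inner_sub_left, sub_eq_zero] at h2
  rw [← h2]

end SpectralTheory

/-! ### Dominated orbits and the pure point subspace -/

section Lattice

variable {Γ : Type*}

theorem inner_delta (y : Γ) (φ : l2 Γ) : inner ℂ (delta y) φ = φ y := by
  let := Classical.decEq Γ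
  exact (lp.inner_single_left (𝕜 := ℂ) (G := fun _ : Γ => ℂ) y (1 : ℂ) φ).trans (by simp)

/-- A vector whose orbit is dominated by a summable function lies in the closed linear span of the
eigenvectors. -/
theorem mem_eigenvectorSpan_of_summable {T : l2 Γ →L[ℂ] l2 Γ} (hT : IsSelfAdjoint T) {ψ : l2 Γ}
    {q : Γ → ℝ} (hq : Summable q)
    (h : ∀ t y, ‖inner ℂ (delta y) (evolution T t ψ)‖ ≤ q y) : ψ ∈ eigenvectorSpan T := by
  -- By unitarity `⟨χ, ψ⟩ = ‖χ‖²` is preserved in time, so `‖χ‖² ≤ ∑ |χ_t(y)| q(y)` at each sampled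
  -- time. The time average of the right side tends to zero termwise, dominated by `‖χ‖ q`, which
  -- forces `χ = 0`.
  let χ := ψ - (eigenvectorSpan T).starProjection ψ
  have hχ : χ ∈ (eigenvectorSpan T)ᗮ := Submodule.sub_starProjection_mem_orthogonal ψ
  obtain ⟨τ, hτ⟩ := exists_tendsto_average_norm_inner hT hχ
  have hq0 : ∀ y, 0 ≤ q y := fun y => (norm_nonneg _).trans (h 0 y)
  have hb : ∀ n : ℕ, ∀ y, ‖inner ℂ (delta y) (evolution T (n * τ) χ)‖ ≤ ‖χ‖ := fun n y => by
    rw [inner_delta, ← norm_evolution hT (n * τ) χ]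
    exact lp.norm_apply_le_norm two_ne_zero _ y
  have hsm : ∀ n : ℕ, Summable fun y => ‖inner ℂ (delta y) (evolution T (n * τ) χ)‖ * q y :=
    fun n => (hq.mul_left ‖χ‖).of_nonneg_of_le (fun y => mul_nonneg (norm_nonneg _) (hq0 y))
      fun y => mul_le_mul_of_nonneg_right (hb n y) (hq0 y)
  have hψχ : inner ℂ χ ψ = ((‖χ‖ ^ 2 : ℝ) : ℂ) := by
    have h1 : inner ℂ χ ((eigenvectorSpan T).starProjection ψ) = 0 :=
      (Submodule.mem_orthogonal' _ _).1 hχ _ (Submodule.starProjection_apply_mem _ ψ)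
    have h2 : ψ = χ + (eigenvectorSpan T).starProjection ψ := by simp [χ]
    conv_lhs => rw [h2]
    rw [inner_add_right, h1, inner_self_eq_norm_sq_to_K]
    simp
  have hle : ∀ n : ℕ,
      ‖χ‖ ^ 2 ≤ ∑' y, ‖inner ℂ (delta y) (evolution T (n * τ) χ)‖ * q y := by
    intro n
    have h1 : ‖inner ℂ (evolution T (n * τ) χ) (evolution T (n * τ) ψ)‖ = ‖χ‖ ^ 2 := by
      rw [inner_evolution_evolution hT, sub_self, evolution_zero, one_apply_eq_self, hψχ,
        Complex.norm_real, Real.norm_of_nonneg (by positivity)]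
    rw [← h1, lp.inner_eq_tsum]
    refine tsum_of_norm_bounded (hsm n).hasSum fun y => ?_
    refine (norm_inner_le_norm _ _).trans ?_
    rw [inner_delta]
    have := h (n * τ) y
    rw [inner_delta] at this
    gcongr
  have hle' : ∀ N : ℕ, 1 ≤ N → ‖χ‖ ^ 2 ≤ ∑' y, ((N : ℝ)⁻¹ * ∑ n ∈ Finset.range N,
      ‖inner ℂ (delta y) (evolution T (n * τ) χ)‖) * q y := by
    intro N hN
    have hN' : (0 : ℝ) < N := by exact_mod_cast hN
    have h1 : ∑' y, ((N : ℝ)⁻¹ * ∑ n ∈ Finset.range N,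
        ‖inner ℂ (delta y) (evolution T (n * τ) χ)‖) * q y =
        (N : ℝ)⁻¹ * ∑ n ∈ Finset.range N,
          ∑' y, ‖inner ℂ (delta y) (evolution T (n * τ) χ)‖ * q y := by
      rw [← Summable.tsum_finsetSum fun n _ => hsm n, ← tsum_mul_left]
      congr 1
      ext y
      rw [mul_assoc, Finset.sum_mul]
    rw [h1, le_inv_mul_iff₀ hN']
    calc (N : ℝ) * ‖χ‖ ^ 2 = ∑ n ∈ Finset.range N, ‖χ‖ ^ 2 := by simp
      _ ≤ _ := Finset.sum_le_sum fun n _ => hle n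
  have hlim : Tendsto (fun N : ℕ => ∑' y, ((N : ℝ)⁻¹ * ∑ n ∈ Finset.range N,
      ‖inner ℂ (delta y) (evolution T (n * τ) χ)‖) * q y) atTop (𝓝 (∑' _ : Γ, (0 : ℝ))) := by
    refine tendsto_tsum_of_dominated_convergence (hq.mul_left ‖χ‖) (fun y => ?_)
      (Eventually.of_forall fun N y => ?_)
    · simpa using (hτ (delta y)).mul_const (q y)
    · rw [norm_mul, Real.norm_of_nonneg (hq0 y), Real.norm_of_nonneg (by positivity)]
      refine mul_le_mul_of_nonneg_right ?_ (hq0 y)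
      rcases Nat.eq_zero_or_pos N with rfl | hN
      · simp
      · have hN' : (0 : ℝ) < N := by exact_mod_cast hN
        rw [inv_mul_le_iff₀ hN']
        calc _ ≤ ∑ n ∈ Finset.range N, ‖χ‖ := Finset.sum_le_sum fun n _ => hb n y
          _ = _ := by simp
  rw [tsum_zero] at hlim
  have h0 : ‖χ‖ ^ 2 ≤ 0 := ge_of_tendsto hlim ((eventually_ge_atTop 1).mono hle')
  have h1 : χ = 0 := by
    rw [← norm_eq_zero, ← sq_eq_zero_iff]
    exact le_antisymm h0 (by positivity)
  have h2 : ψ = (eigenvectorSpan T).starProjection ψ := sub_eq_zero.1 h1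
  rw [h2]
  exact Submodule.starProjection_apply_mem _ ψ

end Lattice

/-! ### From dynamical bounds to eigenfunctions -/

section Localization

variable {Γ : Type*}

theorem topologicalClosure_span_delta :
    (Submodule.span ℂ (Set.range (delta : Γ → l2 Γ))).topologicalClosure = ⊤ := by
  rw [Submodule.topologicalClosure_eq_top_iff, Submodule.eq_bot_iff]
  intro φ hφ
  ext x
  rw [← inner_delta]
  simpa using (Submodule.mem_orthogonal _ _).1 hφ _ (Submodule.subset_span ⟨x, rfl⟩)

theorem apply_mem_of_forall_delta {W : Submodule ℂ (l2 Γ)} (hW : IsClosed (W : Set (l2 Γ)))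
    {A : l2 Γ →L[ℂ] l2 Γ} (h : ∀ x, A (delta x) ∈ W) (φ : l2 Γ) : A φ ∈ W := by
  have h1 : (Submodule.span ℂ (Set.range (delta : Γ → l2 Γ))).topologicalClosure ≤
      W.comap (A : l2 Γ →ₗ[ℂ] l2 Γ) := by
    refine Submodule.topologicalClosure_minimal _ (Submodule.span_le.2 ?_)
      (hW.preimage A.continuous)
    rintro _ ⟨x, rfl⟩
    exact h x
  rw [topologicalClosure_span_delta] at h1
  exact h1 (Submodule.mem_top (x := φ))

theorem norm_spectralProjection_delta_le {T : l2 Γ →L[ℂ] l2 Γ} (hT : IsSelfAdjoint T) {I : Set ℝ}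
    {e : ℝ} (he : e ∈ I) {x y : Γ}
    {q : ℝ} (hq : ∀ t,
      ‖inner ℂ (delta y) (evolution T t (spectralProjection T I (delta x)))‖ ≤ q) :
    ‖spectralProjection T {e} (delta x) y‖ ≤ q := by
  rw [← inner_delta]
  exact norm_inner_spectralProjection_singleton_le hT he hq

theorem spectralProjection_delta_of_simple {T : l2 Γ →L[ℂ] l2 Γ} (hT : IsSelfAdjoint T)
    {e : ℝ} (hs : Module.finrank ℂ (eigenspace T e) = 1) {φ : l2 Γ} (hφ : φ ∈ eigenspace T e)
    (hn : ‖φ‖ = 1) (x y : Γ) :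
    spectralProjection T {e} (delta x) y = conj (φ x) * φ y := by
  have hφ0 : (⟨φ, hφ⟩ : eigenspace T e) ≠ 0 := by
    intro h0
    have : φ = 0 := congrArg Subtype.val h0
    rw [this, norm_zero] at hn
    exact zero_ne_one hn
  obtain ⟨r, hr⟩ := (finrank_eq_one_iff_of_nonzero' _ hφ0).1 hs
    ⟨_, spectralProjection_singleton_mem hT e (delta x)⟩
  have hr' : spectralProjection T {e} (delta x) = r • φ := (congrArg Subtype.val hr).symm
  have h1 : inner ℂ φ (delta x - spectralProjection T {e} (delta x)) = 0 := by
    refine (Submodule.mem_orthogonal _ _).1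
      (Submodule.sub_starProjection_mem_orthogonal (K := spectralSubspace T {e}) _) _ ?_
    rwa [spectralSubspace_singleton hT]
  rw [inner_sub_right, hr', inner_smul_right, inner_self_eq_norm_sq_to_K, hn,
    ← inner_conj_symm, inner_delta] at h1
  have h2 : r = conj (φ x) := by
    simpa using (sub_eq_zero.1 h1).symm
  rw [hr', h2]
  simp

variable [MetricSpace Γ]

/-- Sort the points by `n = ⌊dist x y ^ ζ⌋₊`. Layer `n` lies in the ball of radius `(n + 1)^(1/ζ)`,
so it has at most `C exp(ε(n + 1)/2)` points of weight at most `exp(-εn)`; this leaves a geometric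
series. -/
theorem summable_exp_neg_dist {ζ : ℝ} (hζ : 0 < ζ) (h : SubexponentialGrowth Γ ζ) {ε : ℝ}
    (hε : 0 < ε) (x : Γ) : Summable fun y : Γ => Real.exp (-ε * dist x y ^ ζ) := by
  classical
  obtain ⟨C, hC⟩ := h (ε / 2) (by positivity) x
  let N : Γ → ℕ := fun y => ⌊dist x y ^ ζ⌋₊
  let b : ℕ → ℝ := fun n => C * Real.exp (ε / 2) * Real.exp (-(ε / 2)) ^ n
  have hb : Summable b := (summable_geometric_of_lt_one (Real.exp_pos _).le
    (Real.exp_lt_one_iff.2 (by linarith))).mul_left _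
  have hcount : ∀ (s : Finset Γ) (n : ℕ),
      (((s.filter fun y => N y = n).card : ℕ) : ℝ) * Real.exp (-ε * n) ≤ b n := by
    intro s n
    have hr : (0 : ℝ) ≤ ((n : ℝ) + 1) ^ ζ⁻¹ := by positivity
    obtain ⟨hfin, hcard⟩ := hC _ hr
    rw [← Real.rpow_mul (by positivity), inv_mul_cancel₀ hζ.ne', Real.rpow_one] at hcard
    have h1 : ((s.filter fun y => N y = n).card : ℝ) ≤ C * Real.exp (ε / 2 * (n + 1)) := by
      refine le_trans ?_ hcard
      rw [← Set.ncard_coe_finset]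
      refine Nat.cast_le.2 (Set.ncard_le_ncard (fun y hy => ?_) hfin)
      have hy : N y = n := by simpa using (Finset.mem_filter.1 (Finset.mem_coe.1 hy)).2
      have h2 : dist x y ^ ζ < n + 1 := by rw [← hy]; exact Nat.lt_floor_add_one _
      rw [Metric.mem_closedBall, dist_comm]
      calc dist x y = (dist x y ^ ζ) ^ ζ⁻¹ := by
            rw [← Real.rpow_mul dist_nonneg, mul_inv_cancel₀ hζ.ne', Real.rpow_one]
        _ ≤ _ := Real.rpow_le_rpow (by positivity) h2.le (by positivity)
    calc _ ≤ C * Real.exp (ε / 2 * (n + 1)) * Real.exp (-ε * n) := by gcongr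
      _ = b n := by
        simp only [b]
        rw [← Real.exp_nat_mul, mul_assoc, mul_assoc, ← Real.exp_add, ← Real.exp_add]
        congr 2
        ring
  have hb0 : ∀ n, 0 ≤ b n := fun n =>
    le_trans (by simp) (hcount ∅ n)
  refine summable_of_sum_le (c := ∑' n, b n) (fun y => (Real.exp_pos _).le) fun s => ?_
  calc ∑ y ∈ s, Real.exp (-ε * dist x y ^ ζ)
      ≤ ∑ y ∈ s, Real.exp (-ε * (N y : ℝ)) := by
        refine Finset.sum_le_sum fun y _ => Real.exp_le_exp.2 ?_
        have : (N y : ℝ) ≤ dist x y ^ ζ := Nat.floor_le (by positivity)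
        nlinarith
    _ = ∑ n ∈ s.image N, (s.filter fun y => N y = n).card • Real.exp (-ε * n) :=
        Finset.sum_comp (fun n : ℕ => Real.exp (-ε * n)) N
    _ ≤ ∑ n ∈ s.image N, b n := Finset.sum_le_sum fun n _ => by
        rw [nsmul_eq_mul]; exact hcount s n
    _ ≤ ∑' n, b n := hb.sum_le_tsum _ fun n _ => hb0 n

/-- The evolution of every `δ_x`, restricted to spectral parameters in `I`, is bounded uniformly in
time by a function that decays (sub)exponentially with every rate below `c`. -/
def OrbitsDecay (T : l2 Γ →L[ℂ] l2 Γ) (I : Set ℝ) (c ζ : ℝ) : Prop :=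
  ∀ x, ∀ ε > 0, ∃ A : ℝ, ∀ y t,
    ‖inner ℂ (delta y) (evolution T t (spectralProjection T I (delta x)))‖ ≤
      A * Real.exp (-(c - ε) * dist x y ^ ζ)

variable {T : l2 Γ →L[ℂ] l2 Γ} {I : Set ℝ} {c ζ : ℝ}

theorem hasPurePointSpectrumIn_of_orbitsDecay (hT : IsSelfAdjoint T) (hI : MeasurableSet I)
    (hc : 0 < c) (hζ : 0 < ζ) (hgrowth : SubexponentialGrowth Γ ζ) (h : OrbitsDecay T I c ζ) :
    HasPurePointSpectrumIn T I := by
  have hmem : ∀ φ, spectralProjection T I φ ∈ eigenvectorSpan T := by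
    refine apply_mem_of_forall_delta (Submodule.isClosed_topologicalClosure _) fun x => ?_
    obtain ⟨A, hA⟩ := h x (c / 2) (by positivity)
    refine mem_eigenvectorSpan_of_summable hT
      ((summable_exp_neg_dist hζ hgrowth (half_pos hc) x).mul_left A) fun t y => ?_
    have := hA y t
    rwa [sub_half] at this
  refine ⟨fun φ => ?_, spectrum_inter_interior hT fun ψ hψ => ?_⟩
  · rw [← spectralMeasure_spectralProjection hT hI, ← mem_eigenvectorSpan_iff_isPurePoint hT]
    exact hmem φ
  · exact spectralMeasure_eq_zero_of_inner hT hI ((Submodule.mem_orthogonal _ _).1 hψ _ (hmem ψ))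

/-- For `ζ ≤ 1` the power is subadditive, so moving the base point in the exponent costs only a
constant factor. -/
theorem dist_rpow_le (hζ : 0 < ζ) (hζ' : ζ ≤ 1) (x y z : Γ) :
    dist x z ^ ζ ≤ dist x y ^ ζ + dist y z ^ ζ :=
  (Real.rpow_le_rpow dist_nonneg (dist_triangle x y z) hζ.le).trans
    (Real.rpow_add_le_add_rpow dist_nonneg dist_nonneg hζ.le hζ')

/-- All centers stay within a fixed distance of `x`: at a center `|φ|` is at least `|φ(y₀)| > 0`,
while it decays away from `x`. Decay around `x` therefore becomes decay around every center, with a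
common constant. -/
theorem decays_of_bound (hc : 0 < c) (hζ : 0 < ζ) (hζ' : ζ ≤ 1) {φ : l2 Γ} (x : Γ)
    (h : ∀ ε > 0, ∃ A : ℝ, ∀ y, ‖φ y‖ ≤ A * Real.exp (-(c - ε) * dist x y ^ ζ)) :
    Decays φ c ζ := by
  intro ε hε
  by_cases hφ : ∀ y, φ y = 0
  · exact ⟨1, one_pos, fun x₀ _ y => by rw [hφ y, norm_zero]; positivity⟩
  push Not at hφ
  obtain ⟨y₀, hy₀⟩ := hφ
  have hm : 0 < ‖φ y₀‖ := norm_pos_iff.2 hy₀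
  obtain ⟨B, hB⟩ := h (c / 2) (by positivity)
  rw [sub_half] at hB
  obtain ⟨A, hA⟩ := h ε hε
  have hBpos : 0 < B := by
    have := hm.trans_le (hB y₀)
    exact pos_of_mul_pos_left this (Real.exp_pos _).le
  let R : ℝ := Real.log (B / ‖φ y₀‖) / (c / 2)
  have hR : ∀ x₀, IsCenter φ x₀ → dist x x₀ ^ ζ ≤ R := by
    intro x₀ hx₀
    have h1 : ‖φ y₀‖ ≤ B * Real.exp (-(c / 2) * dist x x₀ ^ ζ) := (hx₀ y₀).trans (hB x₀)
    rw [le_div_iff₀ (by positivity), Real.le_log_iff_exp_le (by positivity),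
      le_div_iff₀ hm]
    calc Real.exp (dist x x₀ ^ ζ * (c / 2)) * ‖φ y₀‖
        ≤ Real.exp (dist x x₀ ^ ζ * (c / 2)) * (B * Real.exp (-(c / 2) * dist x x₀ ^ ζ)) := by
          gcongr
      _ = B * (Real.exp (dist x x₀ ^ ζ * (c / 2)) * Real.exp (-(c / 2) * dist x x₀ ^ ζ)) := by
          ring
      _ = B := by
          rw [← Real.exp_add, show dist x x₀ ^ ζ * (c / 2) + -(c / 2) * dist x x₀ ^ ζ = 0 by ring,
            Real.exp_zero, mul_one]
  by_cases hcε : 0 ≤ c - ε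
  · have hA0 : 0 < A := by
      have := hm.trans_le (hA y₀)
      exact pos_of_mul_pos_left this (Real.exp_pos _).le
    refine ⟨A * Real.exp ((c - ε) * R), by positivity, fun x₀ hx₀ y => (hA y).trans ?_⟩
    rw [mul_assoc, ← Real.exp_add]
    gcongr
    have h1 := dist_rpow_le hζ hζ' y x x₀
    rw [dist_comm y x] at h1
    nlinarith [hR x₀ hx₀]
  -- For `ε > c` the claimed bound does not decay, and `‖φ‖` suffices.
  · refine ⟨‖φ‖ + 1, by positivity, fun x₀ _ y => ?_⟩
    have h1 : (1 : ℝ) ≤ Real.exp (-(c - ε) * dist y x₀ ^ ζ) :=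
      Real.one_le_exp (mul_nonneg (by linarith) (by positivity))
    have h2 := lp.norm_apply_le_norm two_ne_zero φ y
    nlinarith [norm_nonneg φ]

theorem eigenspace_le_of_orbitsDecay (hT : IsSelfAdjoint T) (hc : 0 < c) (hζ : 0 < ζ)
    (hζ' : ζ ≤ 1) (h : OrbitsDecay T I c ζ) {e : ℝ} (he : e ∈ I) :
    eigenspace T e ≤
      (Submodule.span ℂ {φ | φ ∈ eigenspace T e ∧ Decays φ c ζ}).topologicalClosure := by
  intro η hη
  have h1 : spectralProjection T {e} η = η := by
    refine Submodule.starProjection_eq_self_iff.2 ?_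
    rwa [spectralSubspace_singleton hT]
  rw [← h1]
  refine apply_mem_of_forall_delta (Submodule.isClosed_topologicalClosure _) (fun x => ?_) η
  refine Submodule.le_topologicalClosure _ (Submodule.subset_span
    ⟨spectralProjection_singleton_mem hT e _, decays_of_bound hc hζ hζ' x fun ε hε => ?_⟩)
  obtain ⟨A, hA⟩ := h x ε hε
  exact ⟨A, fun y => norm_spectralProjection_delta_le hT he (hA y)⟩

theorem eigenfunctionsDecay_of_orbitsDecay (hT : IsSelfAdjoint T) (hc : 0 < c) (hζ : 0 < ζ)
    (hgrowth : SubexponentialGrowth Γ ζ) (h : OrbitsDecay T I c ζ) :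
    EigenfunctionsDecay T {e ∈ I | Module.finrank ℂ (eigenspace T e) = 1} c ζ := by
  classical
  intro ε hε x₀
  obtain ⟨A, hA⟩ := h x₀ ε hε
  obtain ⟨B, hB⟩ := h x₀ (c / 2) (by positivity)
  rw [sub_half] at hB
  have hsum : Summable fun y => B * Real.exp (-(c / 2) * dist x₀ y ^ ζ) :=
    (summable_exp_neg_dist hζ hgrowth (half_pos hc) x₀).mul_left B
  -- Outside `F` the dominating function sums to less than `1/2`. The choice of `F` precedes that of
  -- `e` and `φ`, so the final constant is uniform.
  obtain ⟨F, hF⟩ := summable_iff_vanishing_norm.1 hsum (1 / 2) (by norm_num)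
  have hA0 : 0 ≤ A := by
    have := (norm_nonneg _).trans (hA x₀ 0)
    exact nonneg_of_mul_nonneg_left this (Real.exp_pos _)
  refine ⟨2 * (F.card + 1) * (A + 1), by positivity, ?_⟩
  rintro e ⟨he, hs⟩ φ hφ hn hx₀ x
  have hprod : ∀ {y : Γ} {q : ℝ}, (∀ t, ‖inner ℂ (delta y)
      (evolution T t (spectralProjection T I (delta x₀)))‖ ≤ q) → ‖φ x₀‖ * ‖φ y‖ ≤ q := by
    intro y q hq
    have := norm_spectralProjection_delta_le hT he hq
    rwa [spectralProjection_delta_of_simple hT hs hφ hn, norm_mul, RCLike.norm_conj] at this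
  have hm1 : ‖φ x₀‖ ≤ 1 := hn ▸ lp.norm_apply_le_norm two_ne_zero φ x₀
  -- At a center `|φ(y)|² ≤ |φ(x₀)| |φ(y)|`, so less than half of the unit mass lies outside `F`.
  -- Inside, each point carries at most `|φ(x₀)|² ≤ |φ(x₀)|`.
  have hlow : 1 ≤ 2 * (F.card + 1) * ‖φ x₀‖ := by
    have h1 : ∀ s : Finset Γ, ∑ y ∈ s, ‖φ y‖ ^ 2 ≤ √(F.card * ‖φ x₀‖ ^ 2 + 1 / 2) ^ 2 := by
      intro s
      rw [Real.sq_sqrt (by positivity), ← Finset.sum_inter_add_sum_sdiff s F]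
      refine add_le_add ?_ ?_
      · calc ∑ y ∈ s ∩ F, ‖φ y‖ ^ 2 ≤ ∑ y ∈ F, ‖φ y‖ ^ 2 :=
              Finset.sum_le_sum_of_subset_of_nonneg Finset.inter_subset_right
                fun _ _ _ => by positivity
          _ ≤ ∑ y ∈ F, ‖φ x₀‖ ^ 2 := Finset.sum_le_sum fun y _ => by
              have := hx₀ y
              gcongr
          _ = _ := by simp
      · calc ∑ y ∈ s \ F, ‖φ y‖ ^ 2
            ≤ ∑ y ∈ s \ F, B * Real.exp (-(c / 2) * dist x₀ y ^ ζ) := by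
              refine Finset.sum_le_sum fun y _ => le_trans ?_ (hprod (hB y))
              rw [sq]
              exact mul_le_mul_of_nonneg_right (hx₀ y) (norm_nonneg _)
          _ ≤ ‖∑ y ∈ s \ F, B * Real.exp (-(c / 2) * dist x₀ y ^ ζ)‖ := Real.le_norm_self _
          _ ≤ 1 / 2 := (hF _ Finset.sdiff_disjoint).le
    have h2 := norm_le_of_sum_sq_le φ (Real.sqrt_nonneg _) h1
    rw [hn, Real.one_le_sqrt] at h2
    have h3 : ‖φ x₀‖ ^ 2 ≤ ‖φ x₀‖ := by nlinarith [norm_nonneg (φ x₀)]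
    have h4 : (F.card : ℝ) * ‖φ x₀‖ ^ 2 ≤ F.card * ‖φ x₀‖ := by gcongr
    nlinarith [norm_nonneg (φ x₀)]
  have h5 := hprod (hA x)
  rw [dist_comm x x₀]
  calc ‖φ x‖ = 1 * ‖φ x‖ := (one_mul _).symm
    _ ≤ 2 * (F.card + 1) * ‖φ x₀‖ * ‖φ x‖ := by gcongr
    _ = 2 * (F.card + 1) * (‖φ x₀‖ * ‖φ x‖) := by ring
    _ ≤ 2 * (F.card + 1) * (A * Real.exp (-(c - ε) * dist x₀ x ^ ζ)) := by gcongr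
    _ ≤ 2 * (F.card + 1) * ((A + 1) * Real.exp (-(c - ε) * dist x₀ x ^ ζ)) := by
        gcongr; linarith
    _ = _ := by ring

end Localization

/-! ### Uniform polynomial approximation and continuity of the evolution -/

section PolynomialApproximation

variable {E : Type*} [NormedAddCommGroup E] [InnerProductSpace ℂ E] [CompleteSpace E]

/-- For bounded self-adjoint operators of norm at most `M`, the operator `f(T)` is the limit of
polynomials in `T` that do not depend on `T`. -/
theorem exists_polynomial_tendsto_fc {f : ℝ → ℝ} (hf : Continuous f) (M : ℝ) :
    ∃ p : ℕ → Polynomial ℝ, ∀ {T : E →L[ℂ] E}, IsSelfAdjoint T → ‖T‖ ≤ M → ∀ φ : E,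
      Tendsto (fun n => ∑ i ∈ Finset.range ((p n).natDegree + 1),
        ((p n).coeff i : ℂ) • (T ^ i) φ) atTop (𝓝 (fc T (fun t => (f t : ℂ)) φ)) := by
  -- Weierstrass approximation on `[-M, M]`, which contains the spectra of all the operators at
  -- once.
  choose p hp using fun n : ℕ => exists_polynomial_near_of_continuousOn (-M) M f hf.continuousOn
    (1 / ((n : ℝ) + 1)) (by positivity)
  refine ⟨p, fun {T} hT hM φ => ?_⟩
  have hspec : ∀ t ∈ spectrum ℝ T, t ∈ Set.Icc (-M) M := by
    intro t ht
    refine abs_le.1 ?_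
    calc |t| ≤ ‖T‖ * ‖(1 : E →L[ℂ] E)‖ := spectrum.norm_le_norm_mul_of_mem ht
      _ ≤ ‖T‖ * 1 := by
          gcongr
          exact ContinuousLinearMap.norm_id_le
      _ ≤ M := by rwa [mul_one]
  have hlim : Tendsto (fun n => cfc (p n).eval T) atTop (𝓝 (cfc f T)) := by
    rw [tendsto_iff_norm_sub_tendsto_zero]
    refine squeeze_zero (fun n => norm_nonneg _) (fun n => ?_)
      tendsto_one_div_add_atTop_nhds_zero_nat
    rw [← cfc_sub _ _ _ (p n).continuous.continuousOn hf.continuousOn]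
    exact norm_cfc_le (by positivity) fun t ht => (hp n t (hspec t ht)).le
  rw [fc_ofReal hT]
  refine (((ContinuousLinearMap.apply ℂ E φ).continuous.tendsto _).comp hlim).congr fun n => ?_
  simp only [Function.comp_apply, ContinuousLinearMap.apply_apply]
  rw [cfc_polynomial (p n) T hT, Polynomial.aeval_eq_sum_range, sum_apply]
  refine Finset.sum_congr rfl fun i _ => ?_
  rw [smul_apply, Complex.coe_smul]

theorem continuous_evolution (T : E →L[ℂ] E) : Continuous fun t : ℝ => evolution T t := by
  let : NormedAlgebra ℚ (E →L[ℂ] E) := NormedAlgebra.restrictScalars ℚ ℂ _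
  exact NormedSpace.exp_continuous.comp (by fun_prop)

end PolynomialApproximation

/-! ### The Anderson Hamiltonian -/

section Hamiltonian

variable {Γ : Type*} (G : SimpleGraph Γ) [G.LocallyFinite] (K : ℕ) (hK : ∀ x, G.degree x ≤ K)
  (lam : ℝ) {a b : ℝ}

theorem delta_self (x : Γ) : (delta x : l2 Γ) x = 1 := by
  simp [delta]

theorem delta_ne {x y : Γ} (h : y ≠ x) : (delta x : l2 Γ) y = 0 := by
  simp [delta, h]

theorem hamiltonian_apply (ω : Γ → Set.Icc a b) (ψ : l2 Γ) (x : Γ) :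
    hamiltonian G K hK lam ω ψ x =
      -∑ y ∈ G.neighborFinset x, (ψ y - ψ x) + (lam : ℂ) * (((ω x : ℝ) : ℂ) * ψ x) := rfl

/-- The operator is bounded, so it is enough that its matrix in the basis `delta` is Hermitian. -/
theorem isSelfAdjoint_hamiltonian (ω : Γ → Set.Icc a b) :
    IsSelfAdjoint (hamiltonian G K hK lam ω) := by
  classical
  set H := hamiltonian G K hK lam ω with hH
  have hsymm : ∀ x y, H (delta x) y = conj (H (delta y) x) := by
    intro x y
    simp only [hH, hamiltonian_apply]
    by_cases hxy : y = x
    · subst hxy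
      simp only [map_add, map_neg, map_sum, map_mul, map_sub, Complex.conj_ofReal, delta_self,
        map_one]
      congr 2
      refine Finset.sum_congr rfl fun z hz => ?_
      have : z ≠ y := ((G.mem_neighborFinset y z).1 hz).ne'
      rw [delta_ne this, map_zero]
    · have h1 : ∀ x y : Γ, ∑ z ∈ G.neighborFinset y, (delta x : l2 Γ) z =
          if G.Adj y x then 1 else 0 := by
        intro x y
        by_cases h : G.Adj y x
        · rw [if_pos h]
          exact (Finset.sum_eq_single (f := fun z => (delta x : l2 Γ) z) x
            (fun z _ hz => delta_ne hz)
            (fun hx => absurd ((G.mem_neighborFinset y x).2 h) hx)).trans (delta_self x)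
        · rw [if_neg h]
          refine Finset.sum_eq_zero fun z hz => delta_ne ?_
          rintro rfl
          exact h ((G.mem_neighborFinset y z).1 hz)
      rw [delta_ne hxy, delta_ne (Ne.symm hxy)]
      simp only [sub_zero, mul_zero, add_zero, map_neg]
      rw [h1 x y, h1 y x]
      by_cases h : G.Adj y x
      · simp [h, h.symm]
      · simp [h, mt G.adj_symm h]
  have hzero : ∀ φ, (ContinuousLinearMap.adjoint H - H) φ ∈ (⊥ : Submodule ℂ (l2 Γ)) := by
    refine apply_mem_of_forall_delta (by simp) fun x => ?_
    rw [Submodule.mem_bot]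
    ext y
    rw [← inner_delta, sub_apply, inner_sub_right, ContinuousLinearMap.adjoint_inner_right,
      inner_delta, hsymm x y, ← inner_conj_symm, inner_delta]
    simp
  rw [ContinuousLinearMap.isSelfAdjoint_iff']
  ext1 φ
  have := hzero φ
  rwa [Submodule.mem_bot, sub_apply, sub_eq_zero] at this

theorem norm_hamiltonian_le (ω : Γ → Set.Icc a b) :
    ‖hamiltonian G K hK lam ω‖ ≤ 2 * K + |lam| * (|a| + |b|) := by
  refine (norm_add_le _ _).trans (add_le_add ?_ ?_)
  · exact LinearMap.mkContinuous_norm_le _ (by positivity) _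
  · rw [norm_smul, Complex.norm_real, Real.norm_eq_abs]
    gcongr
    exact LinearMap.mkContinuous_norm_le _ (by positivity) _

/-! ### Measurability -/

/-- The Hamiltonian has finite range, so each matrix element of a power is a polynomial in finitely
many `ω_z`. -/
theorem measurable_hamiltonian_pow (n : ℕ) (x y : Γ) :
    Measurable fun ω : Γ → Set.Icc a b => (hamiltonian G K hK lam ω ^ n) (delta x) y := by
  induction n generalizing y with
  | zero => simp
  | succ n ih =>
    simp only [pow_succ', mul_apply_eq_comp, hamiltonian_apply]
    have : Measurable fun ω : Γ → Set.Icc a b => ((ω y : ℝ) : ℂ) :=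
      Complex.measurable_ofReal.comp (measurable_subtype_coe.comp (measurable_pi_apply y))
    exact ((Finset.measurable_fun_sum _ fun z _ => (ih z).sub (ih y)).neg).add
      (measurable_const.mul (this.mul (ih y)))

theorem measurable_fc_ofReal_hamiltonian {f : ℝ → ℝ} (hf : Continuous f) (x y : Γ) :
    Measurable fun ω : Γ → Set.Icc a b =>
      fc (hamiltonian G K hK lam ω) (fun t => (f t : ℂ)) (delta x) y := by
  obtain ⟨p, hp⟩ := exists_polynomial_tendsto_fc (E := l2 Γ) hf (2 * K + |lam| * (|a| + |b|))
  refine measurable_of_tendsto_metrizable (f := fun n ω =>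
    ∑ i ∈ Finset.range ((p n).natDegree + 1),
      ((p n).coeff i : ℂ) * (hamiltonian G K hK lam ω ^ i) (delta x) y) (fun n => ?_) ?_
  · exact Finset.measurable_fun_sum _ fun i _ =>
      measurable_const.mul (measurable_hamiltonian_pow G K hK lam i x y)
  · rw [tendsto_pi_nhds]
    intro ω
    have h1 := (tendsto_const_nhds (x := (delta y : l2 Γ))).inner (𝕜 := ℂ)
      (hp (isSelfAdjoint_hamiltonian G K hK lam ω) (norm_hamiltonian_le G K hK lam ω) (delta x))
    rw [inner_delta] at h1
    refine h1.congr fun n => ?_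
    rw [inner_sum]
    refine Finset.sum_congr rfl fun i _ => ?_
    rw [inner_smul_right, inner_delta]

theorem measurable_fc_hamiltonian {f : ℝ → ℂ} (hf : Continuous f) (x y : Γ) :
    Measurable fun ω : Γ → Set.Icc a b => fc (hamiltonian G K hK lam ω) f (delta x) y := by
  have h1 : ∀ ω : Γ → Set.Icc a b, fc (hamiltonian G K hK lam ω) f (delta x) y =
      fc (hamiltonian G K hK lam ω) (fun t => ((f t).re : ℂ)) (delta x) y +
        Complex.I * fc (hamiltonian G K hK lam ω) (fun t => ((f t).im : ℂ)) (delta x) y := by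
    intro ω
    rw [fc_eq_re_add_im hf]
    rfl
  simp only [h1]
  exact (measurable_fc_ofReal_hamiltonian G K hK lam (by fun_prop) x y).add
    (measurable_const.mul (measurable_fc_ofReal_hamiltonian G K hK lam (by fun_prop) x y))

theorem isLocallyClosed_of_ordConnected {I : Set ℝ} (hI : I.OrdConnected) :
    IsLocallyClosed I := by
  have h := hI.isPreconnected.mem_intervals
  simp only [Set.mem_insert_iff, Set.mem_singleton_iff] at h
  rcases h with h | h | h | h | h | h | h | h | h | h <;> rw [h]
  · exact isLocallyClosed_Icc
  · exact isLocallyClosed_Ico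
  · exact isLocallyClosed_Ioc
  · exact isLocallyClosed_Ioo
  · exact isLocallyClosed_Ici
  · exact isLocallyClosed_Ioi
  · exact isLocallyClosed_Iic
  · exact isLocallyClosed_Iio
  · exact isClosed_univ.isLocallyClosed
  · exact isClosed_empty.isLocallyClosed

/-- The spectral measure varies with `ω`, so measurability of `χ_I(H_ω)` needs one sequence that
works for every measure. An open set intersected with a closed one allows convergence at every
point. -/
theorem exists_indicatorApprox_of_isLocallyClosed {I : Set ℝ} (hI : IsLocallyClosed I) :
    ∃ f : ℕ → ℝ → ℝ, ∀ μ : Measure ℝ, IndicatorApprox f I μ := by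
  obtain ⟨U, Z, hU, hZ, rfl⟩ := hI
  have hpos : ∀ n : ℕ, 0 < 1 / ((n : ℝ) + 1) := fun n => by positivity
  have hlim : ∀ F : Set ℝ, IsClosed F → ∀ x, Tendsto
      (fun n => ((thickenedIndicator (hpos n) F x : NNReal) : ℝ)) atTop
      (𝓝 (F.indicator (fun _ => (1 : ℝ)) x)) := by
    intro F hF x
    have h1 := tendsto_pi_nhds.1 (thickenedIndicator_tendsto_indicator_closure hpos
      tendsto_one_div_add_atTop_nhds_zero_nat F) x
    have h2 := (NNReal.continuous_coe.tendsto _).comp h1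
    rw [hF.closure_eq] at h2
    have h3 : F.indicator (fun _ => (1 : ℝ)) x = ((F.indicator (fun _ => 1) x : NNReal) : ℝ) := by
      by_cases hx : x ∈ F <;> simp [hx]
    rw [h3]
    exact h2
  have hmem : ∀ (F : Set ℝ) (n : ℕ) (x : ℝ),
      ((thickenedIndicator (hpos n) F x : NNReal) : ℝ) ∈ Set.Icc (0 : ℝ) 1 := fun F n x =>
    ⟨NNReal.coe_nonneg _, by exact_mod_cast thickenedIndicator_le_one (hpos n) F x⟩
  have hcont : ∀ (F : Set ℝ) (n : ℕ), Continuous fun x =>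
      ((thickenedIndicator (hpos n) F x : NNReal) : ℝ) := fun F n =>
    NNReal.continuous_coe.comp (thickenedIndicator (hpos n) F).continuous
  refine ⟨fun n x => thickenedIndicator (hpos n) Z x * (1 - thickenedIndicator (hpos n) Uᶜ x),
    fun μ => ⟨fun n => ?_, fun n x => ?_, Eventually.of_forall fun x => ?_⟩⟩
  · exact (hcont Z n).mul (continuous_const.sub (hcont Uᶜ n))
  · obtain ⟨h1, h2⟩ := hmem Z n x
    obtain ⟨h3, h4⟩ := hmem Uᶜ n x
    exact ⟨mul_nonneg h1 (by linarith), mul_le_one₀ h2 (by linarith) (by linarith)⟩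
  · have h1 : (U ∩ Z).indicator (fun _ => (1 : ℝ)) x =
        Z.indicator (fun _ => (1 : ℝ)) x * (1 - Uᶜ.indicator (fun _ => (1 : ℝ)) x) := by
      by_cases hxU : x ∈ U <;> by_cases hxZ : x ∈ Z <;> simp [hxU, hxZ]
    rw [h1]
    exact (hlim Z hZ x).mul ((hlim Uᶜ hU.isClosed_compl x).const_sub 1)

theorem measurable_evolution_spectralProjection {I : Set ℝ} (hI : I.OrdConnected) (t : ℝ)
    (x y : Γ) : Measurable fun ω : Γ → Set.Icc a b => inner ℂ (delta y)
      (evolution (hamiltonian G K hK lam ω) t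
        (spectralProjection (hamiltonian G K hK lam ω) I (delta x))) := by
  obtain ⟨f, hf⟩ := exists_indicatorApprox_of_isLocallyClosed (isLocallyClosed_of_ordConnected hI)
  have hfc := (hf 0).continuous
  refine measurable_of_tendsto_metrizable (f := fun n ω => inner ℂ (delta y)
    (evolution (hamiltonian G K hK lam ω) t
      (fc (hamiltonian G K hK lam ω) (fun s => (f n s : ℂ)) (delta x)))) (fun n => ?_) ?_
  · simp only [evolution_eq_fc (isSelfAdjoint_hamiltonian G K hK lam _), ← mul_apply_eq_comp,
      inner_delta]
    have h1 : ∀ ω : Γ → Set.Icc a b, fc (hamiltonian G K hK lam ω)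
        (fun s => Complex.exp (-(Complex.I * t) * s)) *
        fc (hamiltonian G K hK lam ω) (fun s => (f n s : ℂ)) =
        fc (hamiltonian G K hK lam ω) (fun s => Complex.exp (-(Complex.I * t) * s) * f n s) :=
      fun ω => (fc_mul _ (by fun_prop) (by fun_prop)).symm
    simp only [h1]
    exact measurable_fc_hamiltonian G K hK lam (by fun_prop) x y
  · rw [tendsto_pi_nhds]
    intro ω
    exact tendsto_const_nhds.inner (((evolution _ t).continuous.tendsto _).comp
      (tendsto_fc_spectralProjection (isSelfAdjoint_hamiltonian G K hK lam ω) hI.measurableSet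
        (hf _)))

end Hamiltonian

/-! ### From the expectation bound to almost sure decay of orbits -/

section AlmostSure

variable {Γ : Type*} [MetricSpace Γ]

theorem countable_of_subexponentialGrowth [Nonempty Γ] {ζ : ℝ}
    (h : SubexponentialGrowth Γ ζ) : Countable Γ := by
  obtain ⟨x⟩ := ‹Nonempty Γ›
  obtain ⟨C, hC⟩ := h 1 one_pos x
  rw [← Set.countable_univ_iff, ← Metric.iUnion_closedBall_nat x]
  exact Set.countable_iUnion fun n => (hC n (Nat.cast_nonneg n)).1.countable

theorem ae_orbitsDecay [Countable Γ] (G : SimpleGraph Γ) [G.LocallyFinite] (K : ℕ)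
    (hK : ∀ x, G.degree x ≤ K) (lam : ℝ) {a b : ℝ} {P : Measure (Γ → Set.Icc a b)}
    {I : Set ℝ} (hI : I.OrdConnected) {c C ζ : ℝ} (hζ : 0 < ζ)
    (hgrowth : SubexponentialGrowth Γ ζ)
    (hDL : DynamicallyLocalized P (hamiltonian G K hK lam) I c C ζ) :
    ∀ᵐ ω ∂P, OrbitsDecay (hamiltonian G K hK lam ω) I c ζ := by
  let F : (Γ → Set.Icc a b) → Γ → Γ → ℝ → ℂ := fun ω x y t => inner ℂ (delta y)
    (evolution (hamiltonian G K hK lam ω) t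
      (spectralProjection (hamiltonian G K hK lam ω) I (delta x)))
  -- Rational times make the supremum measurable; continuity in `t` recovers real times at the end.
  let Q : Γ → Γ → (Γ → Set.Icc a b) → ℝ≥0∞ := fun x y ω => ⨆ t : ℚ, ‖F ω x y t‖ₑ
  have hQm : ∀ x y, Measurable (Q x y) := fun x y => Measurable.iSup fun t =>
    (measurable_evolution_spectralProjection G K hK lam hI t x y).enorm
  have hQ : ∀ x y, ∫⁻ ω, Q x y ω ∂P ≤ ENNReal.ofReal (C * Real.exp (-c * dist x y ^ ζ)) :=
    fun x y => (lintegral_mono fun ω => iSup_le fun t : ℚ =>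
      le_iSup (fun t : ℝ => ‖F ω x y t‖ₑ) (t : ℝ)).trans (hDL x y)
  -- The weight leaves `exp(-dist(x,y)^ζ / (n + 1))` in expectation, which is summable. The losses
  -- `1/(n + 1)` replace all `ε > 0` by countably many conditions.
  have hae : ∀ (x : Γ) (n : ℕ), ∀ᵐ ω ∂P, ∑' y, ENNReal.ofReal
      (Real.exp ((c - 1 / ((n : ℝ) + 1)) * dist x y ^ ζ)) * Q x y ω < ∞ := by
    intro x n
    refine ae_lt_top (Measurable.tsum fun y => (hQm x y).const_mul _) ?_
    rw [lintegral_tsum fun y => ((hQm x y).const_mul _).aemeasurable]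
    have hs : Summable fun y => C * Real.exp (-(1 / ((n : ℝ) + 1)) * dist x y ^ ζ) :=
      (summable_exp_neg_dist hζ hgrowth (by positivity) x).mul_left C
    refine ne_top_of_le_ne_top hs.tsum_ofReal_ne_top (ENNReal.tsum_le_tsum fun y => ?_)
    rw [lintegral_const_mul _ (hQm x y)]
    calc _ ≤ ENNReal.ofReal (Real.exp ((c - 1 / ((n : ℝ) + 1)) * dist x y ^ ζ)) *
          ENNReal.ofReal (C * Real.exp (-c * dist x y ^ ζ)) := by gcongr; exact hQ x y
      _ = _ := by
        rw [← ENNReal.ofReal_mul (Real.exp_pos _).le, mul_left_comm, ← Real.exp_add]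
        congr 3
        ring
  filter_upwards [ae_all_iff.2 fun x => ae_all_iff.2 fun n => hae x n] with ω hω x ε hε
  obtain ⟨n, hn⟩ := exists_nat_one_div_lt hε
  set S := ∑' y, ENNReal.ofReal
      (Real.exp ((c - 1 / ((n : ℝ) + 1)) * dist x y ^ ζ)) * Q x y ω with hS
  have hSt : S < ∞ := hω x n
  refine ⟨S.toReal, fun y t => ?_⟩
  have hrat : ∀ t : ℚ, ‖F ω x y t‖ ≤ S.toReal * Real.exp (-(c - ε) * dist x y ^ ζ) := by
    intro t
    have h1 : ENNReal.ofReal (Real.exp ((c - 1 / ((n : ℝ) + 1)) * dist x y ^ ζ)) *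
        ‖F ω x y t‖ₑ ≤ S := by
      refine le_trans ?_ (ENNReal.le_tsum y)
      gcongr
      exact le_iSup (fun t : ℚ => ‖F ω x y t‖ₑ) t
    have h2 := ENNReal.toReal_mono hSt.ne h1
    rw [ENNReal.toReal_mul, ENNReal.toReal_ofReal (Real.exp_pos _).le, toReal_enorm] at h2
    calc ‖F ω x y t‖ = Real.exp (-((c - 1 / ((n : ℝ) + 1)) * dist x y ^ ζ)) *
          (Real.exp ((c - 1 / ((n : ℝ) + 1)) * dist x y ^ ζ) * ‖F ω x y t‖) := by
          rw [← mul_assoc, ← Real.exp_add, neg_add_cancel, Real.exp_zero, one_mul]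
      _ ≤ Real.exp (-(c - ε) * dist x y ^ ζ) * S.toReal := by
          gcongr
          have : (0 : ℝ) ≤ dist x y ^ ζ := by positivity
          nlinarith
      _ = _ := mul_comm _ _
  have hcl : IsClosed {t : ℝ | ‖F ω x y t‖ ≤ S.toReal * Real.exp (-(c - ε) * dist x y ^ ζ)} := by
    refine isClosed_le (Continuous.norm (Continuous.inner continuous_const ?_)) continuous_const
    exact (continuous_evolution _).clm_apply continuous_const
  have := hcl.closure_subset_iff.2 (Set.range_subset_iff.2 hrat : Set.range ((↑) : ℚ → ℝ) ⊆ _)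
  rw [Rat.denseRange_cast.closure_range] at this
  exact this (Set.mem_univ t)

end AlmostSure

/-! ### Simplicity of eigenvalues -/

/-- A measurable set in an infinite product is null if all its sections in the direction of one
coordinate are null. -/
theorem infinitePi_null_of_update {ι X : Type*} [DecidableEq ι] [MeasurableSpace X]
    (μ : Measure X) [IsProbabilityMeasure μ] (i : ι) {N : Set (ι → X)} (hN : MeasurableSet N)
    (h : ∀ ω : ι → X, μ {v | Function.update ω i v ∈ N} = 0) :
    Measure.infinitePi (fun _ : ι => μ) N = 0 := by
  set P := Measure.infinitePi (fun _ : ι => μ)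
  have hm : Measurable fun p : (ι → X) × X => Function.update p.1 i p.2 := measurable_update'
  -- Resampling one coordinate independently preserves the product measure, as cylinder sets show;
  -- the claim is then Fubini.
  have hmap : (P.prod μ).map (fun p : (ι → X) × X => Function.update p.1 i p.2) = P := by
    refine Measure.eq_infinitePi _ fun s t ht => ?_
    rw [Measure.map_apply hm (MeasurableSet.pi s.countable_toSet fun j _ => ht j)]
    have hpre : (fun p : (ι → X) × X => Function.update p.1 i p.2) ⁻¹' (Set.pi s t) =
        (Set.pi (s.erase i : Finset ι) t) ×ˢ (if i ∈ s then t i else Set.univ) := by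
      ext ⟨ω, v⟩
      simp only [Set.mem_preimage, Set.mem_pi, Finset.mem_coe, Set.mem_prod, Finset.mem_erase]
      constructor
      · intro hω
        refine ⟨fun j hj => ?_, ?_⟩
        · have := hω j hj.2
          rwa [Function.update_of_ne hj.1] at this
        · split_ifs with hi
          · simpa using hω i hi
          · trivial
      · rintro ⟨hω, hv⟩ j hj
        by_cases hji : j = i
        · subst hji
          rw [if_pos hj] at hv
          simpa using hv
        · rw [Function.update_of_ne hji]
          exact hω j ⟨hji, hj⟩
    rw [hpre, Measure.prod_prod, Measure.infinitePi_pi _ fun j _ => ht j]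
    by_cases hi : i ∈ s
    · rw [if_pos hi, Finset.prod_erase_mul _ _ hi]
    · rw [if_neg hi, measure_univ, mul_one, Finset.erase_eq_of_notMem hi]
  rw [← hmap, Measure.map_apply hm hN, Measure.measure_prod_null (hm hN)]
  exact Eventually.of_forall fun ω => h ω

/-- Each eigenvalue is an atom of the spectral measure of some `delta z`, since otherwise its
eigenvectors would vanish at every site. A finite measure has countably many atoms. -/
theorem countable_eigenvalues {Γ : Type*} [Countable Γ] {T : l2 Γ →L[ℂ] l2 Γ}
    (hT : IsSelfAdjoint T) : {e : ℝ | ∃ ψ ∈ eigenspace T e, ψ ≠ 0}.Countable := by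
  have h : {e : ℝ | ∃ ψ ∈ eigenspace T e, ψ ≠ 0} ⊆
      ⋃ z : Γ, {e : ℝ | 0 < spectralMeasure T (delta z) {e}} := by
    rintro e ⟨ψ, hψ, hψ0⟩
    by_contra hne
    refine hψ0 ?_
    ext z
    simp only [Set.mem_iUnion, not_exists] at hne
    have h0 : spectralMeasure T (delta z) {e} = 0 := by simpa using hne z
    have h1 := inner_eq_zero_of_spectralMeasure hT (measurableSet_singleton e)
      ((mem_eigenspace_iff_spectralMeasure hT).1 hψ) h0
    rw [← inner_conj_symm, inner_delta] at h1
    simpa using h1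
  refine (Set.countable_iUnion fun z => ?_).mono h
  exact Measure.countable_meas_pos_of_disjoint_iUnion
    (fun e : ℝ => measurableSet_singleton e) (fun a b hab => Set.disjoint_singleton.2 hab)

section Simplicity

variable {Γ : Type*} (G : SimpleGraph Γ) [G.LocallyFinite] (K : ℕ) (hK : ∀ x, G.degree x ≤ K)
  (lam : ℝ) {a b : ℝ}

/-- The configurations for which some eigenvalue has both an eigenfunction that vanishes at `x` and
one that does not. -/
def degenerateSet (x : Γ) : Set (Γ → Set.Icc a b) :=
  {ω | ∃ e : ℝ, ∃ φ ∈ eigenspace (hamiltonian G K hK lam ω) e,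
    ∃ ψ ∈ eigenspace (hamiltonian G K hK lam ω) e, φ x ≠ 0 ∧ ψ x = 0 ∧ ψ ≠ 0}

/-- Where `φ(x) ≠ 0`, subtracting a multiple of `φ` from any `ψ` in the eigenspace makes it vanish
at `x`; outside the degenerate set the difference must be zero. -/
theorem finrank_eigenspace_eq_one {ω : Γ → Set.Icc a b}
    (h : ∀ x, ω ∉ degenerateSet G K hK lam x) {e : ℝ} {φ : l2 Γ}
    (hφ : φ ∈ eigenspace (hamiltonian G K hK lam ω) e) (hφ0 : φ ≠ 0) :
    Module.finrank ℂ (eigenspace (hamiltonian G K hK lam ω) e) = 1 := by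
  obtain ⟨x, hx⟩ : ∃ x, φ x ≠ 0 := by
    by_contra hne
    push Not at hne
    exact hφ0 (by ext x; simpa using hne x)
  refine (finrank_eq_one_iff_of_nonzero' ⟨φ, hφ⟩ fun h0 => hφ0 (congrArg Subtype.val h0)).2 ?_
  rintro ⟨ψ, hψ⟩
  have h1 : ψ - (ψ x / φ x) • φ = 0 := by
    by_contra hne
    refine h x ⟨e, φ, hφ, _, Submodule.sub_mem _ hψ (Submodule.smul_mem _ (ψ x / φ x) hφ), hx, ?_,
      hne⟩
    change ψ x - ψ x / φ x * φ x = 0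
    rw [div_mul_cancel₀ _ hx, sub_self]
  exact ⟨ψ x / φ x, Subtype.ext (sub_eq_zero.1 h1).symm⟩

/-! ### Changing the potential at a single site -/

section Update

variable [DecidableEq Γ]

theorem hamiltonian_update_apply (ω : Γ → Set.Icc a b) (x : Γ) (v w : Set.Icc a b) (ψ : l2 Γ) :
    hamiltonian G K hK lam (Function.update ω x v) ψ =
      hamiltonian G K hK lam (Function.update ω x w) ψ +
        ((lam * ((v : ℝ) - w) : ℝ) * ψ x : ℂ) • delta x := by
  ext y
  rw [lp.coeFn_add, Pi.add_apply, lp.coeFn_smul, Pi.smul_apply, hamiltonian_apply,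
    hamiltonian_apply]
  by_cases hy : y = x
  · subst hy
    rw [delta_self]
    simp
    ring
  · rw [delta_ne hy]
    simp [hy]

/-- Pairing the eigenfunctions `φ` for `v` and `ψ` for `w` and using symmetry leaves `λ (v - w) φ(x)
conj(ψ(x)) = 0`. -/
theorem subsingleton_update_eigenvalue (hlam : lam ≠ 0) (ω : Γ → Set.Icc a b) (x : Γ) (e : ℝ) :
    {v | ∃ φ ∈ eigenspace (hamiltonian G K hK lam (Function.update ω x v)) e,
      φ x ≠ 0}.Subsingleton := by
  rintro v ⟨φ, hφ, hφx⟩ w ⟨ψ, hψ, hψx⟩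
  rw [mem_eigenspace] at hφ hψ
  have h1 := ContinuousLinearMap.isSelfAdjoint_iff_isSymmetric.1
    (isSelfAdjoint_hamiltonian G K hK lam (Function.update ω x w)) ψ φ
  have h2 : inner ℂ ψ (hamiltonian G K hK lam (Function.update ω x v) φ) =
      inner ℂ ψ (hamiltonian G K hK lam (Function.update ω x w) φ) +
        ((lam * ((v : ℝ) - w) : ℝ) * φ x : ℂ) * conj (ψ x) := by
    rw [hamiltonian_update_apply G K hK lam ω x v w, inner_add_right, inner_smul_right,
      ← inner_conj_symm ψ (delta x), inner_delta]
  have h1' : inner ℂ (hamiltonian G K hK lam (Function.update ω x w) ψ) φ =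
    inner ℂ ψ (hamiltonian G K hK lam (Function.update ω x w) φ) := h1
  rw [← h1', hφ, hψ, inner_smul_left, inner_smul_right, Complex.conj_ofReal] at h2
  have h3 : ((lam * ((v : ℝ) - w) : ℝ) * φ x : ℂ) * conj (ψ x) = 0 := by
    simpa using h2
  have h4 : (v : ℝ) - w = 0 := by
    simpa [hφx, hψx, hlam, ← Complex.ofReal_sub] using h3
  exact Subtype.ext (sub_eq_zero.1 h4)

/-- Since `ψ(x) = 0`, the function `ψ` is also an eigenfunction of the unmodified operator, so `e`
ranges over countably many values that do not depend on `v`. Each of them allows at most one `v`. -/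
theorem countable_update_degenerateSet [Countable Γ] (hlam : lam ≠ 0) (ω : Γ → Set.Icc a b)
    (x : Γ) : {v | Function.update ω x v ∈ degenerateSet G K hK lam x}.Countable := by
  have h : {v | Function.update ω x v ∈ degenerateSet G K hK lam x} ⊆
      ⋃ e ∈ {e : ℝ | ∃ ψ ∈ eigenspace (hamiltonian G K hK lam ω) e, ψ ≠ 0},
        {v | ∃ φ ∈ eigenspace (hamiltonian G K hK lam (Function.update ω x v)) e, φ x ≠ 0} := by
    rintro v ⟨e, φ, hφ, ψ, hψ, hφx, hψx, hψ0⟩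
    refine Set.mem_biUnion (x := e) ⟨ψ, ?_, hψ0⟩ ⟨φ, hφ, hφx⟩
    rw [mem_eigenspace] at hψ ⊢
    have h1 := hamiltonian_update_apply G K hK lam ω x (ω x) v ψ
    rw [hψx, mul_zero, zero_smul, add_zero, Function.update_eq_self] at h1
    rw [h1, hψ]
  refine Set.Countable.mono h (Set.Countable.biUnion
    (countable_eigenvalues (isSelfAdjoint_hamiltonian G K hK lam ω)) fun e _ => ?_)
  exact (subsingleton_update_eigenvalue G K hK lam hlam ω x e).countable

end Update

/-- The set of `(ω, e, φ, ψ)` for which `φ` and `ψ` are functions in the unit ball of `ℓ²(Γ)` that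
solve the eigenvalue equation, with `|φ(x)|` and `|ψ(z)|` bounded below and `ψ(x) = 0`. -/
def degenerateSolutions (x z : Γ) (n : ℕ) : Set ((Γ → Set.Icc a b) × Set.Icc (-(n : ℝ)) n ×
    (Γ → Metric.closedBall (0 : ℂ) 1) × (Γ → Metric.closedBall (0 : ℂ) 1)) :=
  {p | (∀ s : Finset Γ, ∑ y ∈ s, ‖(p.2.2.1 y : ℂ)‖ ^ 2 ≤ 1) ∧
    (∀ s : Finset Γ, ∑ y ∈ s, ‖(p.2.2.2 y : ℂ)‖ ^ 2 ≤ 1) ∧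
    (∀ y, -∑ w ∈ G.neighborFinset y, ((p.2.2.1 w : ℂ) - p.2.2.1 y) +
      (lam : ℂ) * (((p.1 y : ℝ) : ℂ) * p.2.2.1 y) = ((p.2.1 : ℝ) : ℂ) * p.2.2.1 y) ∧
    (∀ y, -∑ w ∈ G.neighborFinset y, ((p.2.2.2 w : ℂ) - p.2.2.2 y) +
      (lam : ℂ) * (((p.1 y : ℝ) : ℂ) * p.2.2.2 y) = ((p.2.1 : ℝ) : ℂ) * p.2.2.2 y) ∧
    1 / ((n : ℝ) + 1) ≤ ‖(p.2.2.1 x : ℂ)‖ ∧ (p.2.2.2 x : ℂ) = 0 ∧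
    1 / ((n : ℝ) + 1) ≤ ‖(p.2.2.2 z : ℂ)‖}

/-- Every condition involves only finitely many coordinates, so it is closed in the product
topology; this is why the norm bound is stated through finite sums. -/
theorem isClosed_degenerateSolutions (x z : Γ) (n : ℕ) :
    IsClosed (degenerateSolutions G lam x z n (a := a) (b := b)) := by
  have hφ : ∀ y, Continuous fun p : (Γ → Set.Icc a b) × Set.Icc (-(n : ℝ)) n ×
      (Γ → Metric.closedBall (0 : ℂ) 1) × (Γ → Metric.closedBall (0 : ℂ) 1) =>
      (p.2.2.1 y : ℂ) := fun y => by fun_prop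
  have hψ : ∀ y, Continuous fun p : (Γ → Set.Icc a b) × Set.Icc (-(n : ℝ)) n ×
      (Γ → Metric.closedBall (0 : ℂ) 1) × (Γ → Metric.closedBall (0 : ℂ) 1) =>
      (p.2.2.2 y : ℂ) := fun y => by fun_prop
  have hω : ∀ y, Continuous fun p : (Γ → Set.Icc a b) × Set.Icc (-(n : ℝ)) n ×
      (Γ → Metric.closedBall (0 : ℂ) 1) × (Γ → Metric.closedBall (0 : ℂ) 1) =>
      ((p.1 y : ℝ) : ℂ) := fun y => by fun_prop
  have he : Continuous fun p : (Γ → Set.Icc a b) × Set.Icc (-(n : ℝ)) n ×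
      (Γ → Metric.closedBall (0 : ℂ) 1) × (Γ → Metric.closedBall (0 : ℂ) 1) =>
      ((p.2.1 : ℝ) : ℂ) := by fun_prop
  have hsum : ∀ {f : (Γ → Set.Icc a b) × Set.Icc (-(n : ℝ)) n ×
      (Γ → Metric.closedBall (0 : ℂ) 1) × (Γ → Metric.closedBall (0 : ℂ) 1) → Γ → ℂ},
      (∀ y, Continuous fun p => f p y) →
      IsClosed {p | ∀ s : Finset Γ, ∑ y ∈ s, ‖f p y‖ ^ 2 ≤ 1} := by
    intro f hf
    simp only [Set.ofPred_forall]
    exact isClosed_iInter fun s => isClosed_le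
      (continuous_finsetSum _ fun y _ => (hf y).norm.pow 2) continuous_const
  have heq : ∀ {f : (Γ → Set.Icc a b) × Set.Icc (-(n : ℝ)) n ×
      (Γ → Metric.closedBall (0 : ℂ) 1) × (Γ → Metric.closedBall (0 : ℂ) 1) → Γ → ℂ},
      (∀ y, Continuous fun p => f p y) →
      IsClosed {p | ∀ y, -∑ w ∈ G.neighborFinset y, (f p w - f p y) +
        (lam : ℂ) * (((p.1 y : ℝ) : ℂ) * f p y) = ((p.2.1 : ℝ) : ℂ) * f p y} := by
    intro f hf
    simp only [Set.ofPred_forall]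
    exact isClosed_iInter fun y => isClosed_eq
      ((continuous_finsetSum _ fun w _ => (hf w).sub (hf y)).neg.add
        (continuous_const.mul ((hω y).mul (hf y)))) (he.mul (hf y))
  exact (hsum hφ).inter ((hsum hψ).inter ((heq hφ).inter ((heq hψ).inter
    ((isClosed_le continuous_const (hφ x).norm).inter
      ((isClosed_eq (hψ x) continuous_const).inter
        (isClosed_le continuous_const (hψ z).norm))))))

theorem degenerateSet_eq (x : Γ) :
    degenerateSet G K hK lam x (a := a) (b := b) =
      ⋃ (z : Γ) (n : ℕ), Prod.fst '' degenerateSolutions G lam x z n (a := a) (b := b) := by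
  ext ω
  simp only [Set.mem_iUnion, Set.mem_image]
  constructor
  · rintro ⟨e, φ, hφ, ψ, hψ, hφx, hψx, hψ0⟩
    have hφ0 : φ ≠ 0 := fun h => hφx (by simp [h])
    obtain ⟨z, hz⟩ : ∃ z, ψ z ≠ 0 := by
      by_contra hne
      push Not at hne
      exact hψ0 (by ext y; simpa using hne y)
    have hunit : ∀ f : l2 Γ, f ≠ 0 → ‖((‖f‖⁻¹ : ℝ) : ℂ) • f‖ = 1 := fun f hf => by
      rw [norm_smul, Complex.norm_real, norm_inv, norm_norm, inv_mul_cancel₀ (norm_ne_zero_iff.2 hf)]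
    set φ' := ((‖φ‖⁻¹ : ℝ) : ℂ) • φ with hφ'
    set ψ' := ((‖ψ‖⁻¹ : ℝ) : ℂ) • ψ with hψ'
    have hφ'n : ‖φ'‖ = 1 := hunit φ hφ0
    have hψ'n : ‖ψ'‖ = 1 := hunit ψ hψ0
    have hφ'e : φ' ∈ eigenspace (hamiltonian G K hK lam ω) e := Submodule.smul_mem _ _ hφ
    have hψ'e : ψ' ∈ eigenspace (hamiltonian G K hK lam ω) e := Submodule.smul_mem _ _ hψ
    have hφ'x : 0 < ‖φ' x‖ := norm_pos_iff.2 (by simp [hφ', hφx, hφ0])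
    have hψ'z : 0 < ‖ψ' z‖ := norm_pos_iff.2 (by simp [hψ', hz, hψ0])
    have hψ'x : ψ' x = 0 := by simp [hψ', hψx]
    -- After normalization one integer `n` can quantify both non-vanishing conditions and bound the
    -- energy, which places the data in a compact space.
    obtain ⟨n₁, hn₁⟩ := exists_nat_one_div_lt (lt_min hφ'x hψ'z)
    obtain ⟨n₂, hn₂⟩ := exists_nat_ge |e|
    obtain ⟨n, hn₁', hn₂'⟩ : ∃ n : ℕ, n₁ ≤ n ∧ n₂ ≤ n :=
      ⟨max n₁ n₂, le_max_left _ _, le_max_right _ _⟩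
    have hn : 1 / ((n : ℝ) + 1) < min ‖φ' x‖ ‖ψ' z‖ := by
      refine lt_of_le_of_lt ?_ hn₁
      gcongr
    have hen : |e| ≤ (n : ℝ) := hn₂.trans (by exact_mod_cast hn₂')
    have hball : ∀ {f : l2 Γ}, ‖f‖ = 1 → ∀ y, f y ∈ Metric.closedBall (0 : ℂ) 1 := by
      intro f hf y
      rw [mem_closedBall_zero_iff, ← hf]
      exact lp.norm_apply_le_norm two_ne_zero f y
    have heqn : ∀ {f : l2 Γ}, f ∈ eigenspace (hamiltonian G K hK lam ω) e → ∀ y,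
        -∑ w ∈ G.neighborFinset y, (f w - f y) + (lam : ℂ) * (((ω y : ℝ) : ℂ) * f y) =
          (e : ℂ) * f y := by
      intro f hf y
      rw [← hamiltonian_apply G K hK lam, mem_eigenspace.1 hf]
      rfl
    have hsq : ∀ {f : l2 Γ}, ‖f‖ = 1 → ∀ s : Finset Γ, ∑ y ∈ s, ‖f y‖ ^ 2 ≤ 1 := by
      intro f hf s
      simpa [hf] using sum_sq_le f s
    clear_value φ' ψ'
    refine ⟨z, n, (ω, ⟨e, abs_le.1 hen⟩, fun y => ⟨φ' y, hball hφ'n y⟩,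
      fun y => ⟨ψ' y, hball hψ'n y⟩), ⟨hsq hφ'n, hsq hψ'n, heqn hφ'e, heqn hψ'e, ?_, hψ'x, ?_⟩, rfl⟩
    · exact (hn.trans_le (min_le_left _ _)).le
    · exact (hn.trans_le (min_le_right _ _)).le
  · rintro ⟨z, n, ⟨ω, e, φ, ψ⟩, ⟨hφs, hψs, hφe, hψe, hφx, hψx, hψz⟩, rfl⟩
    have hpos : (0 : ℝ) < 1 / ((n : ℝ) + 1) := by positivity
    have hmem : ∀ (f : Γ → Metric.closedBall (0 : ℂ) 1)
        (hs : ∀ s : Finset Γ, ∑ y ∈ s, ‖(f y : ℂ)‖ ^ 2 ≤ 1),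
        (∀ y, -∑ w ∈ G.neighborFinset y, ((f w : ℂ) - f y) +
          (lam : ℂ) * (((ω y : ℝ) : ℂ) * f y) = ((e : ℝ) : ℂ) * f y) →
        (⟨fun y => (f y : ℂ), memlp_of_sum_sq_le hs⟩ : l2 Γ) ∈
          eigenspace (hamiltonian G K hK lam ω) e := by
      intro f hs hf
      rw [mem_eigenspace]
      ext y
      exact hf y
    refine ⟨e, _, hmem φ hφs hφe, _, hmem ψ hψs hψe, ?_, hψx, fun h0 => ?_⟩
    · exact norm_pos_iff.1 (hpos.trans_le hφx)
    · have h1 : (ψ z : ℂ) = 0 := congrArg (fun f : l2 Γ => f z) h0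
      rw [h1, norm_zero] at hψz
      exact absurd hψz (not_le.2 hpos)

/-- Energies and functions range over a compact space, so projecting to `ω` maps closed sets to
closed sets, and the degenerate set is a countable union of these. -/
theorem measurableSet_degenerateSet [Countable Γ] (x : Γ) :
    MeasurableSet (degenerateSet G K hK lam x (a := a) (b := b)) := by
  rw [degenerateSet_eq]
  refine MeasurableSet.iUnion fun z => MeasurableSet.iUnion fun n => IsClosed.measurableSet ?_
  exact isClosedMap_fst_of_compactSpace _ (isClosed_degenerateSolutions G lam x z n)

/-- If the single-site distribution has no atoms, then almost surely all eigenvalues are simple. -/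
theorem ae_finrank_eigenspace_eq_one [Countable Γ] (hlam : lam ≠ 0) (μ : Measure (Set.Icc a b))
    [IsProbabilityMeasure μ] (hμ : ∀ r, μ {r} = 0) :
    ∀ᵐ ω ∂(Measure.infinitePi fun _ : Γ => μ), ∀ e : ℝ,
      ∀ φ ∈ eigenspace (hamiltonian G K hK lam ω) e, φ ≠ 0 →
        Module.finrank ℂ (eigenspace (hamiltonian G K hK lam ω) e) = 1 := by
  classical
  have h0 : ∀ x, Measure.infinitePi (fun _ : Γ => μ) (degenerateSet G K hK lam x) = 0 := by
    intro x
    refine infinitePi_null_of_update μ x (measurableSet_degenerateSet G K hK lam x) fun ω => ?_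
    have hc := countable_update_degenerateSet G K hK lam hlam ω x
    rw [← Set.biUnion_of_singleton {v | Function.update ω x v ∈ degenerateSet G K hK lam x}]
    exact (measure_biUnion_null_iff hc).2 fun v _ => hμ v
  filter_upwards [ae_all_iff.2 fun x => measure_eq_zero_iff_ae_notMem.1 (h0 x)] with ω hω e φ hφ hφ0
  exact finrank_eigenspace_eq_one G K hK lam hω hφ hφ0

end Simplicity

end Anderson

end

theorem mainTheorem4 {Γ : Type*} [MetricSpace Γ] (G : SimpleGraph Γ) [G.LocallyFinite]
    (hG : G.Connected) (K : ℕ) (hK : ∀ x, G.degree x ≤ K)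
    (lam : ℝ) (hlam : 0 < lam) (a b : ℝ) (hab : a < b)
    (μ : MeasureTheory.Measure (Set.Icc a b)) [MeasureTheory.IsProbabilityMeasure μ]
    (I : Set ℝ) (hI : I.OrdConnected)
    (c C ζ : ℝ) (hc : 0 < c) (hC : 0 < C) (hζ : 0 < ζ) (hζ' : ζ ≤ 1)
    (hgrowth : Anderson.SubexponentialGrowth Γ ζ)
    (hDL : Anderson.DynamicallyLocalized (MeasureTheory.Measure.infinitePi fun _ : Γ => μ)
      (Anderson.hamiltonian G K hK lam) I c C ζ) :
    ∀ᵐ ω ∂(MeasureTheory.Measure.infinitePi fun _ : Γ => μ),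
      Anderson.HasPurePointSpectrumIn (Anderson.hamiltonian G K hK lam ω) I ∧
      (∀ e ∈ I, Anderson.eigenspace (Anderson.hamiltonian G K hK lam ω) e ≤
        (Submodule.span ℂ
          {φ | φ ∈ Anderson.eigenspace (Anderson.hamiltonian G K hK lam ω) e ∧
            Anderson.Decays φ c ζ}).topologicalClosure) ∧
      Anderson.EigenfunctionsDecay (Anderson.hamiltonian G K hK lam ω)
        {e ∈ I | Module.finrank ℂ
          (Anderson.eigenspace (Anderson.hamiltonian G K hK lam ω) e) = 1} c ζ ∧
      ((∀ r, μ {r} = 0) →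
        Anderson.EigenfunctionsDecay (Anderson.hamiltonian G K hK lam ω) I c ζ) := by
  have : Nonempty Γ := hG.nonempty
  have : Countable Γ := Anderson.countable_of_subexponentialGrowth hgrowth
  -- The absence of atoms does not depend on `ω`, so it may be placed inside the almost sure
  -- statement.
  have hsimple : ∀ᵐ ω ∂(MeasureTheory.Measure.infinitePi fun _ : Γ => μ), (∀ r, μ {r} = 0) →
      ∀ e : ℝ, ∀ φ ∈ Anderson.eigenspace (Anderson.hamiltonian G K hK lam ω) e, φ ≠ 0 →
        Module.finrank ℂ (Anderson.eigenspace (Anderson.hamiltonian G K hK lam ω) e) = 1 := by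
    by_cases hμ : ∀ r, μ {r} = 0
    · filter_upwards [Anderson.ae_finrank_eigenspace_eq_one G K hK lam hlam.ne' μ hμ] with ω hω _
      exact hω
    · exact Filter.Eventually.of_forall fun ω h => absurd h hμ
  filter_upwards [Anderson.ae_orbitsDecay G K hK lam hI hζ hgrowth hDL, hsimple] with ω hω hs
  have hH := Anderson.isSelfAdjoint_hamiltonian G K hK lam ω
  have h3 := Anderson.eigenfunctionsDecay_of_orbitsDecay hH hc hζ hgrowth hω
  refine ⟨Anderson.hasPurePointSpectrumIn_of_orbitsDecay hH hI.measurableSet hc hζ hgrowth hω,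
    fun e he => Anderson.eigenspace_le_of_orbitsDecay hH hc hζ hζ' hω he, h3,
    fun hμ ε hε x₀ => ?_⟩
  obtain ⟨C', hC', h⟩ := h3 ε hε x₀
  refine ⟨C', hC', fun e he φ hφ hn => h e ⟨he, hs hμ e φ hφ ?_⟩ φ hφ hn⟩
  rintro rfl
  simp at hn
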